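/- **Theorem 3.** Let $G$ be a real rational function, in lowest terms, with denominator of degree $2$, and let $A\in\mathbb R^{2\times 2}$, $B\in\mathbb R^{2\times 1}$, $C\in\mathbb R^{1\times 2}$ be a (minimal) state space realization of it, $G(s)=C(sI-A)^{-1}B$. Consider the relay feedback system with an ideal relay, $$\dot x = Ax - B\,\mathrm{sign}(Cx),\qquad x\in\mathbb R^2 .$$ Its trajectories are the Filippov solutions on $[0,\infty)$: locally absolutely continuous functions $x$ such that for almost every $t>0$ one has $\dot x(t) = Ax(t)-uB$ for some $u$ with $u=1$ if $Cx(t)>0$, $u=-1$ if $Cx(t)<0$, and $u\in[-1,1]$ if $Cx(t)=0$. Suppose that $G$ is proper (hence strictly proper, as the realization has no feedthrough term), Hurwitz stable (all poles have negative real part), nonminimum phase (it has a positive real zero, which is then its only zero) and has positive DC gain, $G(0)>0$. Then there is a limit cycle $\Gamma\subset\mathbb R^2$, that is, the locus of a nonconstant periodic trajectory $c$, isolated among the loci of such trajectories, with the following properties. 1. $\Gamma$ is symmetric: $\Gamma=-\Gamma$. 2. $\Gamma$ is unimodal: in each period (of length the least period of $c$) the relay output $\mathrm{sign}(Cc(t))$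 changes sign exactly twice, and $Cc(t)=0$ only at these two instants. 3. Every trajectory $x$ other than the equilibrium solution $x\equiv 0$ converges asymptotically to $\Gamma$: $\mathrm{dist}(x(t),\Gamma)\to 0$ as $t\to\infty$. 4. From every initial state $\xi\in\mathbb R^2$ (including $\xi=0$) there starts at least one trajectory that converges asymptotically to $\Gamma$. -/

import Mathlib

namespace RelayFeedback

open Polynomial

/-- The transfer function `C (sI - A)⁻¹ B` of the system `ẋ = A x + B u`, `y = C x`,
as a real rational function of `s`. (The matrix `sI - A` is always invertible over the field of
rational functions, since its determinant is the characteristic polynomial of `A`.) -/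
noncomputable def transferFunction (A : Matrix (Fin 2) (Fin 2) ℝ) (B C : Fin 2 → ℝ) : RatFunc ℝ :=
  (fun i => RatFunc.C (C i)) ⬝ᵥ
    (Matrix.mulVec ((RatFunc.X : RatFunc ℝ) • (1 : Matrix (Fin 2) (Fin 2) (RatFunc ℝ))
      - A.map (fun a => RatFunc.C a))⁻¹ (fun i => RatFunc.C (B i)))

/-- A transfer function is proper if the degree of its numerator does not exceed that of its
denominator. (The numerator and the denominator are coprime.) -/
def IsProper (G : RatFunc ℝ) : Prop := G.num.natDegree ≤ G.denom.natDegree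

/-- Hurwitz stability: all poles lie in the open left half plane. -/
def IsHurwitz (G : RatFunc ℝ) : Prop := ∀ s : ℂ, aeval s G.denom = 0 → s.re < 0

/-- Nonminimum phase: there is a positive real zero. -/
def IsNonminimumPhase (G : RatFunc ℝ) : Prop := ∃ z : ℝ, 0 < z ∧ G.num.eval z = 0

/-- The DC gain `G(0)`. -/
noncomputable def dcGain (G : RatFunc ℝ) : ℝ := RatFunc.eval (RingHom.id ℝ) 0 G

/-- The ideal relay, `sign y`, made set-valued at the switching point `y = 0`. -/
def relay (y : ℝ) : Set ℝ :=
  {u | (0 < y → u = 1) ∧ (y < 0 → u = -1) ∧ (y = 0 → u ∈ Set.Icc (-1 : ℝ) 1)}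

/-- The right hand side of the Filippov differential inclusion of `ẋ = A x - B sign (C x)`. -/
def filippovField (A : Matrix (Fin 2) (Fin 2) ℝ) (B C : Fin 2 → ℝ) (x : Fin 2 → ℝ) :
    Set (Fin 2 → ℝ) :=
  {v | ∃ u ∈ relay (C ⬝ᵥ x), v = A.mulVec x - u • B}

/-- Trajectories of the relay feedback system: Filippov solutions on `[0, ∞)`, that is, locally
absolutely continuous functions that satisfy the differential inclusion at almost every time.
(The values of `x` at negative times play no role.) -/
structure IsTrajectory (A : Matrix (Fin 2) (Fin 2) ℝ) (B C : Fin 2 → ℝ)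
    (x : ℝ → Fin 2 → ℝ) : Prop where
  absolutelyContinuous : ∀ T : ℝ, 0 < T → AbsolutelyContinuousOnInterval x 0 T
  inclusion : ∀ᵐ t : ℝ, 0 < t → ∃ v ∈ filippovField A B C (x t), HasDerivAt x v t

/-- The locus in state space of a function on `[0, ∞)`. -/
def locus (x : ℝ → Fin 2 → ℝ) : Set (Fin 2 → ℝ) := x '' Set.Ici 0

/-- `x` is a periodic trajectory whose least positive period is `T`. In particular `x` is not
constant, since a constant function has no least positive period. -/
structure IsPeriodicTrajectory (A : Matrix (Fin 2) (Fin 2) ℝ) (B C : Fin 2 → ℝ)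
    (x : ℝ → Fin 2 → ℝ) (T : ℝ) : Prop where
  isTrajectory : IsTrajectory A B C x
  isLeast : IsLeast {S : ℝ | 0 < S ∧ ∀ t : ℝ, 0 ≤ t → x (t + S) = x t} T

/-- A limit cycle is an isolated periodic trajectory: some neighbourhood of its locus contains no
other periodic orbit. -/
structure IsLimitCycle (A : Matrix (Fin 2) (Fin 2) ℝ) (B C : Fin 2 → ℝ)
    (x : ℝ → Fin 2 → ℝ) (T : ℝ) : Prop where
  isPeriodic : IsPeriodicTrajectory A B C x T
  isolated : ∃ U : Set (Fin 2 → ℝ), IsOpen U ∧ locus x ⊆ U ∧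
    ∀ (y : ℝ → Fin 2 → ℝ) (S : ℝ), IsPeriodicTrajectory A B C y S →
      locus y ⊆ U → locus y = locus x

/-- The locus is symmetric with respect to the origin. -/
def IsSymmetric (x : ℝ → Fin 2 → ℝ) : Prop := ∀ ξ : Fin 2 → ℝ, ξ ∈ locus x ↔ -ξ ∈ locus x

/-- The relay output `sign (C x)` changes sign at time `t`. -/
def SwitchesAt (C : Fin 2 → ℝ) (x : ℝ → Fin 2 → ℝ) (t : ℝ) : Prop :=
  ((∀ᶠ s in nhdsWithin t (Set.Iio t), 0 < C ⬝ᵥ x s) ∧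
    (∀ᶠ s in nhdsWithin t (Set.Ioi t), C ⬝ᵥ x s < 0)) ∨
  ((∀ᶠ s in nhdsWithin t (Set.Iio t), C ⬝ᵥ x s < 0) ∧
    (∀ᶠ s in nhdsWithin t (Set.Ioi t), 0 < C ⬝ᵥ x s))

/-- A `T`-periodic trajectory is unimodal if the relay output changes sign exactly twice per
period, and the switching line is met at those two instants only (there is no sliding). The
half-open window `(0, T]` is used because `x` is a trajectory on `[0, ∞)`. -/
structure IsUnimodal (C : Fin 2 → ℝ) (x : ℝ → Fin 2 → ℝ) (T : ℝ) : Prop where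
  two_switches : {t : ℝ | t ∈ Set.Ioc 0 T ∧ SwitchesAt C x t}.ncard = 2
  switches_of_zero : ∀ t ∈ Set.Ioc 0 T, C ⬝ᵥ x t = 0 → SwitchesAt C x t

/-- `x` converges asymptotically to the set `Γ`. -/
def ConvergesTo (x : ℝ → Fin 2 → ℝ) (Γ : Set (Fin 2 → ℝ)) : Prop :=
  Filter.Tendsto (fun t => Metric.infDist (x t) Γ) Filter.atTop (nhds 0)

end RelayFeedback

/-! In the coordinates (y, p) = (Cx, CAx) the system reads ẏ = p + k u, ṗ = -b y - a p - u (b g + a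
k), where a, b, g > 0 and u is the relay value. The positive zero z = b g / k forces k = -CB > 0.
Hence the line y = 0 repels on both sides where |p| < k, and it is crossed at once where |p| > k.
Sliding along the segment |p| ≤ k obeys ṗ = z p, so only the equilibrium slides forever
(`Relay.Traj.eq_zero`). Any other trajectory has y ≠ 0 at some time. It then follows a linear flow
towards an equilibrium on the opposite side of the line, and so it hits the line, necessarily with
|p| > k (`Relay.Traj.exists_crossing`). From there on it is unique and consists of half cycles
alternating in sign (`Relay.Traj.follows`).

A half cycle is determined by its duration t. Let V(t) be |ẏ| at departure and R(t) at arrival. The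
relay jump adds 2k to the speed at each crossing, so successive durations satisfy V(t') = R(t) + 2k.
On the interval where β > 0, each of V, R and V - R is strictly increasing; moreover V tends to 0 at
0, and V - R is unbounded. So V - R = 2k has exactly one solution, and the recursion moves
monotonically towards it from either side (`Relay.tendsto_τ_iterate`).

The fixed duration gives an orbit made of two opposite half cycles. Convergence of durations and
speeds makes every other nonequilibrium trajectory approach it (`Relay.Follows.convergesTo`). A
periodic trajectory approaching this closed orbit must lie on it, so there is no other nonconstant
periodic orbit (`Relay.locus_eq_of_periodic`). States on the repelling segment, the origin included,
can leave it at once (`Relay.exists_traj`). Finally, coprimality of numerator and denominator makes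
the realization observable, so (Cx, CAx) are indeed coordinates. -/

namespace RelayFeedback

open Set Filter Topology MeasureTheory

/-! ### Two facts of one-variable calculus -/

/-- A strictly positive derivative forces a strict increase between two points. -/
theorem lt_of_hasDerivAt_pos {f f' : ℝ → ℝ} {s t : ℝ} (hst : s < t)
    (hf : ∀ x ∈ Icc s t, HasDerivAt f (f' x) x) (hpos : ∀ x ∈ Ioo s t, 0 < f' x) :
    f s < f t := by
  obtain ⟨c, hc, h⟩ := exists_hasDerivAt_eq_slope f f' hst
    (fun x hx => (hf x hx).continuousAt.continuousWithinAt) (fun x hx => hf x (Ioo_subset_Icc_self hx))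
  have h1 := hpos c hc
  rw [h] at h1
  have := (div_pos_iff_of_pos_right (sub_pos.2 hst)).1 h1
  linarith

/-- The first time at which a continuous function that starts above the level `c` reaches it. -/
theorem exists_first_hit {f : ℝ → ℝ} {s t c : ℝ} (hst : s ≤ t) (hf : ContinuousOn f (Icc s t))
    (hs : c < f s) (ht : f t ≤ c) :
    ∃ r ∈ Ioc s t, f r = c ∧ ∀ q ∈ Ico s r, c < f q := by
  have hK : IsCompact (Icc s t ∩ f ⁻¹' Iic c) :=
    isCompact_Icc.of_isClosed_subset (hf.preimage_isClosed_of_isClosed isClosed_Icc isClosed_Iic)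
      inter_subset_left
  obtain ⟨r, ⟨hr, hrc⟩, hmin⟩ := hK.exists_isLeast ⟨t, ⟨hst, le_rfl⟩, ht⟩
  have hlt : ∀ q ∈ Ico s r, c < f q := fun q hq => by
    by_contra hcon
    exact absurd (hmin ⟨⟨hq.1, hq.2.le.trans hr.2⟩, not_lt.1 hcon⟩) (not_le.2 hq.2)
  have hsr : s < r := by
    refine lt_of_le_of_ne hr.1 fun h => ?_
    subst h
    exact absurd hrc (not_le.2 hs)
  refine ⟨r, ⟨hsr, hr.2⟩, le_antisymm hrc ?_, hlt⟩
  have hcl : r ∈ closure (Ico s r) := by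
    rw [closure_Ico hsr.ne]
    exact ⟨hsr.le, le_rfl⟩
  have hcw : ContinuousWithinAt f (Ico s r) r :=
    (hf r hr).mono fun q hq => ⟨hq.1, hq.2.le.trans hr.2⟩
  exact closure_minimal (t := Ici c) (by rintro _ ⟨q, hq, rfl⟩; exact (hlt q hq).le) isClosed_Ici
    (hcw.mem_closure_image hcl)

/-! ### The impulse response and its fundamental system -/

/-- A second order relay system in companion form, with characteristic polynomial `s² + a s + b`,
high frequency gain `-k` and DC gain `g`. The functions `β` and `γ = β'` are the impulse response
of `s² + a s + b` and its derivative. -/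
structure Relay where
  (a b k g : ℝ)
  a_pos : 0 < a
  b_pos : 0 < b
  k_pos : 0 < k
  g_pos : 0 < g
  (β γ : ℝ → ℝ)
  β_zero : β 0 = 0
  γ_zero : γ 0 = 1
  hasDerivAt_β : ∀ t, HasDerivAt β (γ t) t
  hasDerivAt_γ : ∀ t, HasDerivAt γ (-a * γ t - b * β t) t
  tendsto_β : Tendsto β atTop (𝓝 0)
  tendsto_γ : Tendsto γ atTop (𝓝 0)

/-- Existence of the impulse response of a Hurwitz polynomial `s² + a s + b`. -/
theorem exists_impulse_response {a b : ℝ} (ha : 0 < a) (hb : 0 < b) :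
    ∃ β γ : ℝ → ℝ, β 0 = 0 ∧ γ 0 = 1 ∧ (∀ t, HasDerivAt β (γ t) t) ∧
      (∀ t, HasDerivAt γ (-a * γ t - b * β t) t) ∧
      Tendsto β atTop (𝓝 0) ∧ Tendsto γ atTop (𝓝 0) := by
  have hexp : ∀ c : ℝ, 0 < c → Tendsto (fun t : ℝ => Real.exp (-c * t)) atTop (𝓝 0) := fun c hc =>
    Real.tendsto_exp_atBot.comp (tendsto_id.const_mul_atTop_of_neg (neg_lt_zero.2 hc))
  have hder : ∀ c t : ℝ, HasDerivAt (fun t : ℝ => Real.exp (-c * t)) (-c * Real.exp (-c * t)) t :=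
    fun c t => by
      have := (((hasDerivAt_id t).const_mul (-c)).exp)
      simpa [mul_comm] using this
  -- Complex, double or distinct real characteristic roots.
  rcases lt_trichotomy (a ^ 2 / 4) b with h | h | h
  · set ω := Real.sqrt (b - a ^ 2 / 4) with hω
    have hω0 : 0 < ω := Real.sqrt_pos.2 (by linarith)
    have hω2 : ω ^ 2 = b - a ^ 2 / 4 := Real.sq_sqrt (by linarith)
    have hs : ∀ t, HasDerivAt (fun t => Real.sin (ω * t)) (ω * Real.cos (ω * t)) t := fun t => by
      have := ((hasDerivAt_id t).const_mul ω).sin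
      simpa [mul_comm] using this
    have hc : ∀ t, HasDerivAt (fun t => Real.cos (ω * t)) (-ω * Real.sin (ω * t)) t := fun t => by
      have := ((hasDerivAt_id t).const_mul ω).cos
      simpa [mul_comm] using this
    have hE := hexp (a / 2) (by linarith)
    have hbs : Tendsto (fun t => Real.exp (-(a / 2) * t) * Real.sin (ω * t)) atTop (𝓝 0) :=
      hE.zero_mul_isBoundedUnder_le (isBoundedUnder_of ⟨1, fun t => by
        simpa using Real.abs_sin_le_one (ω * t)⟩)
    have hbc : Tendsto (fun t => Real.exp (-(a / 2) * t) * Real.cos (ω * t)) atTop (𝓝 0) :=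
      hE.zero_mul_isBoundedUnder_le (isBoundedUnder_of ⟨1, fun t => by
        simpa using Real.abs_cos_le_one (ω * t)⟩)
    refine ⟨fun t => Real.exp (-(a / 2) * t) * Real.sin (ω * t) * ω⁻¹,
      fun t => Real.exp (-(a / 2) * t) * Real.cos (ω * t)
        - a / 2 * ω⁻¹ * (Real.exp (-(a / 2) * t) * Real.sin (ω * t)), by simp, by simp,
        fun t => ?_, fun t => ?_, ?_, ?_⟩
    · refine (((hder (a / 2) t).mul (hs t)).mul_const ω⁻¹).congr_deriv ?_
      field_simp
      ring
    · refine (((hder (a / 2) t).mul (hc t)).sub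
        (((hder (a / 2) t).mul (hs t)).const_mul (a / 2 * ω⁻¹))).congr_deriv ?_
      have : b = ω ^ 2 + a ^ 2 / 4 := by linarith
      rw [this]
      field_simp
      ring
    · simpa using hbs.mul_const ω⁻¹
    · simpa using hbc.sub (hbs.const_mul (a / 2 * ω⁻¹))
  · have hE := hexp (a / 2) (by linarith)
    have htE : Tendsto (fun t : ℝ => t * Real.exp (-(a / 2) * t)) atTop (𝓝 0) := by
      have := Real.tendsto_pow_mul_exp_neg_atTop_nhds_zero 1
      have h2 := (this.comp (tendsto_id.const_mul_atTop (show (0 : ℝ) < a / 2 by linarith))).const_mul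
        (a / 2)⁻¹
      simp only [mul_zero] at h2
      refine h2.congr fun t => ?_
      simp only [Function.comp, id, pow_one, neg_mul]
      field_simp
    refine ⟨fun t => t * Real.exp (-(a / 2) * t),
      fun t => Real.exp (-(a / 2) * t) - a / 2 * (t * Real.exp (-(a / 2) * t)), by simp, by simp,
        fun t => ?_, fun t => ?_, htE, ?_⟩
    · refine ((hasDerivAt_id t).mul (hder (a / 2) t)).congr_deriv ?_
      simp only [id]
      ring
    · refine ((hder (a / 2) t).sub (((hasDerivAt_id t).mul (hder (a / 2) t)).const_mul
        (a / 2))).congr_deriv ?_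
      simp only [id, ← h]
      ring
    · simpa using hE.sub (htE.const_mul (a / 2))
  · set ω := Real.sqrt (a ^ 2 / 4 - b) with hω
    have hω0 : 0 < ω := Real.sqrt_pos.2 (by linarith)
    have hω2 : ω ^ 2 = a ^ 2 / 4 - b := Real.sq_sqrt (by linarith)
    -- Both roots -a/2 ± ω are negative because their product b is positive.
    have hωa : ω < a / 2 := by nlinarith
    have h1 := hexp (a / 2 - ω) (by linarith)
    have h2 := hexp (a / 2 + ω) (by linarith)
    have hb' : b = (a / 2 - ω) * (a / 2 + ω) := by linarith
    refine ⟨fun t => (Real.exp (-(a / 2 - ω) * t) - Real.exp (-(a / 2 + ω) * t)) * (2 * ω)⁻¹,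
      fun t => (-(a / 2 - ω) * Real.exp (-(a / 2 - ω) * t)
        - (-(a / 2 + ω)) * Real.exp (-(a / 2 + ω) * t)) * (2 * ω)⁻¹, by simp, ?_,
        fun t => ?_, fun t => ?_, ?_, ?_⟩
    · simp only [mul_zero, Real.exp_zero]
      field_simp
      ring
    · exact ((hder _ t).sub (hder _ t)).mul_const _
    · refine ((((hder _ t).const_mul _).sub ((hder _ t).const_mul _)).mul_const _).congr_deriv ?_
      rw [hb']
      field_simp
      ring
    · simpa using (h1.sub h2).mul_const (2 * ω)⁻¹
    · simpa using ((h1.const_mul (-(a / 2 - ω))).sub (h2.const_mul (-(a / 2 + ω)))).mul_const (2 * ω)⁻¹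

namespace Relay

variable (D : Relay)

/-- The companion of `β`: the solution of the homogeneous equation with value `1` and slope `0`
at the origin. -/
def α (t : ℝ) : ℝ := D.γ t + D.a * D.β t

theorem α_zero : D.α 0 = 1 := by simp [α, D.γ_zero, D.β_zero]

theorem hasDerivAt_α (t : ℝ) : HasDerivAt D.α (-D.b * D.β t) t :=
  ((D.hasDerivAt_γ t).add ((D.hasDerivAt_β t).const_mul D.a)).congr_deriv (by ring)

theorem continuous_β : Continuous D.β :=
  continuous_iff_continuousAt.2 fun t => (D.hasDerivAt_β t).continuousAt

theorem continuous_γ : Continuous D.γ :=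
  continuous_iff_continuousAt.2 fun t => (D.hasDerivAt_γ t).continuousAt

theorem tendsto_α : Tendsto D.α atTop (𝓝 0) := by
  have h := D.tendsto_γ.add (D.tendsto_β.const_mul D.a)
  rwa [mul_zero, add_zero] at h

theorem hasDerivAt_exp (t : ℝ) :
    HasDerivAt (fun t => Real.exp (D.a * t)) (D.a * Real.exp (D.a * t)) t := by
  have := ((hasDerivAt_id t).const_mul D.a).exp
  simpa [mul_comm] using this

theorem exp_neg_mul_exp (t : ℝ) : Real.exp (-D.a * t) * Real.exp (D.a * t) = 1 := by
  rw [← Real.exp_add]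
  simp

/-- Liouville's formula. -/
theorem exp_mul_wronskian (t : ℝ) :
    Real.exp (D.a * t) * (D.α t * D.γ t + D.b * D.β t ^ 2) = 1 := by
  have h : ∀ s, HasDerivAt (fun t => Real.exp (D.a * t) * (D.α t * D.γ t + D.b * D.β t ^ 2)) 0 s :=
    fun s => by
      refine ((D.hasDerivAt_exp s).mul (((D.hasDerivAt_α s).mul (D.hasDerivAt_γ s)).add
        (((D.hasDerivAt_β s).pow 2).const_mul D.b))).congr_deriv ?_
      simp only [Pi.mul_apply, Pi.add_apply, Pi.pow_apply, α]
      push_cast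
      ring
  have := is_const_of_deriv_eq_zero (fun s => (h s).differentiableAt) (fun s => (h s).deriv) t 0
  simpa [D.α_zero, D.γ_zero, D.β_zero] using this

theorem wronskian (t : ℝ) : D.α t * D.γ t + D.b * D.β t ^ 2 = Real.exp (-D.a * t) := by
  have h1 := D.exp_mul_wronskian t
  have h2 := D.exp_neg_mul_exp t
  have h3 := Real.exp_pos (D.a * t)
  apply mul_left_cancel₀ h3.ne'
  linarith

/-! ### Departure and arrival speeds as functions of the half-cycle duration -/

/-- The times up to which `β` is positive. These are the possible times spent on one side of the
switching line. -/
def dom : Set ℝ := {t | 0 < t ∧ ∀ s ∈ Ioc 0 t, 0 < D.β s}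

variable {D}

theorem β_pos {t : ℝ} (ht : t ∈ D.dom) : 0 < D.β t := ht.2 t ⟨ht.1, le_rfl⟩

theorem mem_dom_of_le {s t : ℝ} (ht : t ∈ D.dom) (hs : 0 < s) (hst : s ≤ t) : s ∈ D.dom :=
  ⟨hs, fun r hr => ht.2 r ⟨hr.1, hr.2.trans hst⟩⟩

theorem Icc_subset_dom {s t : ℝ} (hs : s ∈ D.dom) (ht : t ∈ D.dom) : Icc s t ⊆ D.dom :=
  fun _ hr => mem_dom_of_le ht (hs.1.trans_le hr.1) hr.2

theorem α_lt_one {t : ℝ} (ht : t ∈ D.dom) : D.α t < 1 := by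
  have := lt_of_hasDerivAt_pos (f := fun t => -D.α t) ht.1 (fun s _ => (D.hasDerivAt_α s).neg)
    (fun s hs => by
      have := ht.2 s ⟨hs.1, hs.2.le⟩
      have := mul_pos D.b_pos this
      linarith)
  simp only [D.α_zero] at this
  linarith

theorem γ_lt_exp {t : ℝ} (ht : t ∈ D.dom) : D.γ t < Real.exp (-D.a * t) := by
  have := lt_of_hasDerivAt_pos (f := fun t => -(Real.exp (D.a * t) * D.γ t))
    (f' := fun t => D.b * (Real.exp (D.a * t) * D.β t)) ht.1
    (fun s _ => ((D.hasDerivAt_exp s).mul (D.hasDerivAt_γ s)).neg.congr_deriv (by ring))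
    (fun s hs => mul_pos D.b_pos (mul_pos (Real.exp_pos _) (ht.2 s ⟨hs.1, hs.2.le⟩)))
  simp only [D.γ_zero, mul_zero, Real.exp_zero, mul_one] at this
  have h3 := Real.exp_pos (D.a * t)
  have h2 := D.exp_neg_mul_exp t
  nlinarith

/-- Multiplied by exp(a t), this compares aβ with (exp(a t) - 1)γ. The difference vanishes at 0 and
has derivative bβ(exp(a t) - 1). It is the sign condition for the derivative of V - R. -/
theorem γ_mul_lt {t : ℝ} (ht : t ∈ D.dom) :
    D.γ t * (1 - Real.exp (-D.a * t)) < D.a * Real.exp (-D.a * t) * D.β t := by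
  have := lt_of_hasDerivAt_pos (f := fun t => D.a * D.β t - (Real.exp (D.a * t) * D.γ t - D.γ t))
    (f' := fun t => D.b * D.β t * (Real.exp (D.a * t) - 1)) ht.1
    (fun s _ => (((D.hasDerivAt_β s).const_mul D.a).sub
      (((D.hasDerivAt_exp s).mul (D.hasDerivAt_γ s)).sub (D.hasDerivAt_γ s))).congr_deriv (by ring))
    (fun s hs => mul_pos (mul_pos D.b_pos (ht.2 s ⟨hs.1, hs.2.le⟩))
      (sub_pos.2 (Real.one_lt_exp_iff.2 (mul_pos D.a_pos hs.1))))
  simp only [D.γ_zero, D.β_zero, mul_zero, Real.exp_zero, mul_one, sub_self] at this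
  have h2 := D.exp_neg_mul_exp t
  have h4 := mul_pos (Real.exp_pos (-D.a * t)) this
  linear_combination h4 - D.γ t * h2

variable (D)

/-- The departure speed from the switching line for which the time of return is `t`. -/
noncomputable def V (t : ℝ) : ℝ := D.g * (1 - D.α t) / D.β t

/-- The speed at which the switching line is reached after a time `t` spent on one side. -/
noncomputable def R (t : ℝ) : ℝ := D.g * (Real.exp (-D.a * t) - D.γ t) / D.β t

variable {D}

theorem V_pos {t : ℝ} (ht : t ∈ D.dom) : 0 < D.V t :=
  div_pos (mul_pos D.g_pos (sub_pos.2 (α_lt_one ht))) (β_pos ht)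

theorem R_pos {t : ℝ} (ht : t ∈ D.dom) : 0 < D.R t :=
  div_pos (mul_pos D.g_pos (sub_pos.2 (γ_lt_exp ht))) (β_pos ht)

theorem V_sub_R (D : Relay) {t : ℝ} (ht : D.β t ≠ 0) :
    D.V t - D.R t = D.g * ((1 - Real.exp (-D.a * t)) / D.β t - D.a) := by
  simp only [V, R, α]
  field_simp
  ring

theorem hasDerivAt_exp_neg (D : Relay) (t : ℝ) :
    HasDerivAt (fun t => Real.exp (-D.a * t)) (-D.a * Real.exp (-D.a * t)) t := by
  have := ((hasDerivAt_id t).const_mul (-D.a)).exp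
  simpa [mul_comm] using this

/-- Liouville's formula collapses the quotient rule: V' = R/β, and likewise R' = exp(-a t) V/β.
Positivity of each speed is thus monotonicity of the other. -/
theorem hasDerivAt_V {t : ℝ} (ht : t ∈ D.dom) :
    HasDerivAt D.V (D.g * (Real.exp (-D.a * t) - D.γ t) / D.β t ^ 2) t := by
  refine ((((hasDerivAt_const t (1 : ℝ)).sub (D.hasDerivAt_α t)).const_mul D.g).div
    (D.hasDerivAt_β t) (β_pos ht).ne').congr_deriv ?_
  rw [← D.wronskian t]
  simp only [Pi.sub_apply, α]
  ring

theorem hasDerivAt_R {t : ℝ} (ht : t ∈ D.dom) :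
    HasDerivAt D.R (D.g * (Real.exp (-D.a * t) * (1 - D.α t)) / D.β t ^ 2) t := by
  refine ((((D.hasDerivAt_exp_neg t).sub (D.hasDerivAt_γ t)).const_mul D.g).div
    (D.hasDerivAt_β t) (β_pos ht).ne').congr_deriv ?_
  have := D.wronskian t
  simp only [Pi.sub_apply, α] at this ⊢
  congr 1
  linear_combination (D.g) * this

theorem V_lt {s t : ℝ} (hs : s ∈ D.dom) (ht : t ∈ D.dom) (hst : s < t) : D.V s < D.V t :=
  lt_of_hasDerivAt_pos hst (fun _ hr => hasDerivAt_V (Icc_subset_dom hs ht hr)) fun _ hr =>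
    have hr' := Icc_subset_dom hs ht (Ioo_subset_Icc_self hr)
    div_pos (mul_pos D.g_pos (sub_pos.2 (γ_lt_exp hr'))) (pow_pos (β_pos hr') 2)

theorem R_lt {s t : ℝ} (hs : s ∈ D.dom) (ht : t ∈ D.dom) (hst : s < t) : D.R s < D.R t :=
  lt_of_hasDerivAt_pos hst (fun _ hr => hasDerivAt_R (Icc_subset_dom hs ht hr)) fun _ hr =>
    have hr' := Icc_subset_dom hs ht (Ioo_subset_Icc_self hr)
    div_pos (mul_pos D.g_pos (mul_pos (Real.exp_pos _) (sub_pos.2 (α_lt_one hr'))))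
      (pow_pos (β_pos hr') 2)

theorem V_sub_R_lt {s t : ℝ} (hs : s ∈ D.dom) (ht : t ∈ D.dom) (hst : s < t) :
    D.V s - D.R s < D.V t - D.R t := by
  refine lt_of_hasDerivAt_pos (f := fun t => D.V t - D.R t) hst
    (fun _ hr => (hasDerivAt_V (Icc_subset_dom hs ht hr)).sub
      (hasDerivAt_R (Icc_subset_dom hs ht hr))) fun r hr => ?_
  have hr' := Icc_subset_dom hs ht (Ioo_subset_Icc_self hr)
  have h := γ_mul_lt hr'
  rw [← sub_div]
  refine div_pos ?_ (pow_pos (β_pos hr') 2)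
  rw [← mul_sub]
  refine mul_pos D.g_pos ?_
  simp only [α]
  linarith

theorem V_inj {s t : ℝ} (hs : s ∈ D.dom) (ht : t ∈ D.dom) (h : D.V s = D.V t) : s = t :=
  (show StrictMonoOn D.V D.dom from fun _ h1 _ h2 h => V_lt h1 h2 h).injOn hs ht h

theorem continuousOn_V {s : Set ℝ} (hs : s ⊆ D.dom) : ContinuousOn D.V s :=
  fun _ hr => (hasDerivAt_V (hs hr)).continuousAt.continuousWithinAt

theorem continuousOn_R {s : Set ℝ} (hs : s ⊆ D.dom) : ContinuousOn D.R s :=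
  fun _ hr => (hasDerivAt_R (hs hr)).continuousAt.continuousWithinAt

/-- β starts at 0 with slope 1. -/
theorem eventually_mem_dom (D : Relay) : ∀ᶠ t in 𝓝[>] 0, t ∈ D.dom := by
  have h := D.continuous_γ.tendsto 0
  rw [D.γ_zero] at h
  obtain ⟨δ, hδ, h⟩ := Metric.eventually_nhds_iff.1 (h.eventually (lt_mem_nhds zero_lt_one))
  filter_upwards [Ioo_mem_nhdsGT hδ] with t ht
  refine ⟨ht.1, fun s hs => ?_⟩
  have := lt_of_hasDerivAt_pos (f := D.β) hs.1 (fun r _ => D.hasDerivAt_β r) (fun r hr => h (by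
    rw [Real.dist_eq, sub_zero, abs_of_pos hr.1]
    exact hr.2.trans (hs.2.trans_lt ht.2)))
  rwa [D.β_zero] at this

/-- The slope of α at 0 vanishes while that of β is 1, so (1 - α)/β tends to 0. -/
theorem tendsto_V_zero (D : Relay) : Tendsto D.V (𝓝[>] 0) (𝓝 0) := by
  have hα := (D.hasDerivAt_α 0).tendsto_slope_zero_right
  have hβ := (D.hasDerivAt_β 0).tendsto_slope_zero_right
  simp only [zero_add, D.α_zero, D.β_zero, D.γ_zero, sub_zero, smul_eq_mul, mul_zero] at hα hβ
  have := (hα.div hβ one_ne_zero).const_mul (-D.g)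
  simp only [zero_div, mul_zero] at this
  refine this.congr' ?_
  filter_upwards [D.eventually_mem_dom] with t ht
  have h1 := ht.1.ne'
  have h2 := (β_pos ht).ne'
  simp only [Pi.div_apply, V]
  field_simp
  ring

/-- The difference between the departure and the return speed is unbounded. -/
theorem exists_V_sub_R_gt (D : Relay) {s : ℝ} (hs : s ∈ D.dom) (M : ℝ) :
    ∃ t ∈ D.dom, s ≤ t ∧ M < D.V t - D.R t := by
  set c := 1 - Real.exp (-D.a * s) with hc
  have hcpos : 0 < c := by
    rw [hc, sub_pos, Real.exp_lt_one_iff]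
    have := mul_pos D.a_pos hs.1
    linarith
  -- Chosen so that g (M' - a) = max M 0 + g exceeds M.
  set M' := max M 0 / D.g + D.a + 1 with hM'
  have hM'pos : 0 < M' := by
    have := div_nonneg (le_max_right M 0) D.g_pos.le
    have := D.a_pos
    linarith
  -- The first bound puts the level ε below β(s); the second makes c/ε at least M'. Since β tends to
  -- 0, it reaches this level after s, and the first such time still lies in `dom`, whether or not β
  -- later vanishes.
  set ε := min (D.β s / 2) (c / M') with hε
  have hεpos : 0 < ε := lt_min (by linarith [β_pos hs]) (div_pos hcpos hM'pos)
  obtain ⟨N, hN⟩ := eventually_atTop.1 (D.tendsto_β.eventually (gt_mem_nhds hεpos))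
  obtain ⟨t, ht, htε, hlt⟩ := exists_first_hit (le_max_left s N) D.continuous_β.continuousOn
    (show ε < D.β s from (min_le_left _ _).trans_lt (by linarith [β_pos hs]))
    (hN _ (le_max_right s N)).le
  have htd : t ∈ D.dom := by
    refine ⟨hs.1.trans ht.1, fun r hr => ?_⟩
    rcases le_or_gt r s with h | h
    · exact hs.2 r ⟨hr.1, h⟩
    rcases hr.2.eq_or_lt with h' | h'
    · rw [h', htε]
      exact hεpos
    · exact hεpos.trans (hlt r ⟨h.le, h'⟩)
  refine ⟨t, htd, ht.1.le, ?_⟩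
  rw [V_sub_R D (β_pos htd).ne', htε]
  have h1 : c < 1 - Real.exp (-D.a * t) := by
    rw [hc]
    have : Real.exp (-D.a * t) < Real.exp (-D.a * s) := Real.exp_lt_exp.2 (by
      have := mul_lt_mul_of_pos_left ht.1 D.a_pos
      linarith)
    linarith
  have h2 : M' ≤ (1 - Real.exp (-D.a * t)) / ε := by
    rw [le_div_iff₀ hεpos]
    have : ε * M' ≤ c := by
      rw [← le_div_iff₀ hM'pos]
      exact min_le_right _ _
    linarith
  have h3 : D.g * (max M 0 / D.g) = max M 0 := by
    have := D.g_pos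
    field_simp
  have h4 : D.g * (max M 0 / D.g + 1) ≤ D.g * ((1 - Real.exp (-D.a * t)) / ε - D.a) :=
    mul_le_mul_of_nonneg_left (by linarith) D.g_pos.le
  have := le_max_left M 0
  have := D.g_pos
  linarith

theorem exists_V_eq (D : Relay) {v : ℝ} (hv : 0 < v) : ∃ t ∈ D.dom, D.V t = v := by
  obtain ⟨s, hs, hsv⟩ :=
    (D.eventually_mem_dom.and (D.tendsto_V_zero.eventually (gt_mem_nhds hv))).exists
  obtain ⟨t, ht, hst, htv⟩ := D.exists_V_sub_R_gt hs v
  have := R_pos ht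
  obtain ⟨r, hr, h⟩ := intermediate_value_Icc hst (continuousOn_V (Icc_subset_dom hs ht))
    ⟨hsv.le, show v ≤ D.V t by linarith⟩
  exact ⟨r, Icc_subset_dom hs ht hr, h⟩

/-! ### The half-cycle map, its fixed point and global attraction -/

/-- The time spent on one side of the switching line after a departure at speed `v`. -/
noncomputable def τ (D : Relay) (v : ℝ) : ℝ :=
  if h : 0 < v then (D.exists_V_eq h).choose else 0

theorem τ_mem {v : ℝ} (hv : 0 < v) : D.τ v ∈ D.dom := by
  rw [τ, dif_pos hv]
  exact (D.exists_V_eq hv).choose_spec.1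

theorem V_τ {v : ℝ} (hv : 0 < v) : D.V (D.τ v) = v := by
  rw [τ, dif_pos hv]
  exact (D.exists_V_eq hv).choose_spec.2

/-- The departure speed of the next half cycle. -/
noncomputable def next (D : Relay) (v : ℝ) : ℝ := D.R (D.τ v) + 2 * D.k

theorem next_pos {v : ℝ} (hv : 0 < v) : 0 < D.next v := by
  have := R_pos (τ_mem (D := D) hv)
  have := D.k_pos
  simp only [next]
  linarith

theorem exists_fixed (D : Relay) : ∃ v, 0 < v ∧ D.next v = v := by
  have hk : 0 < 2 * D.k := by linarith [D.k_pos]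
  obtain ⟨s, hs, hsv⟩ :=
    (D.eventually_mem_dom.and (D.tendsto_V_zero.eventually (gt_mem_nhds hk))).exists
  obtain ⟨t, ht, hst, htv⟩ := D.exists_V_sub_R_gt hs (2 * D.k)
  have := R_pos hs
  have hsub := Icc_subset_dom hs ht
  obtain ⟨r, hr, h⟩ := intermediate_value_Icc hst ((continuousOn_V hsub).sub (continuousOn_R hsub))
    (show 2 * D.k ∈ Icc (D.V s - D.R s) (D.V t - D.R t) from ⟨by linarith, htv.le⟩)
  have hrd := hsub hr
  refine ⟨D.V r, V_pos hrd, ?_⟩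
  have : D.τ (D.V r) = r := V_inj (τ_mem (V_pos hrd)) hrd (V_τ (V_pos hrd))
  simp only [Pi.sub_apply] at h
  rw [next, this]
  linarith

/-- The departure speed on the limit cycle. -/
noncomputable def vStar (D : Relay) : ℝ := D.exists_fixed.choose

theorem vStar_pos (D : Relay) : 0 < D.vStar := D.exists_fixed.choose_spec.1

theorem next_vStar (D : Relay) : D.next D.vStar = D.vStar := D.exists_fixed.choose_spec.2

theorem iterate_pos {v : ℝ} (hv : 0 < v) (n : ℕ) : 0 < D.next^[n] v := by
  induction n with
  | zero => exact hv
  | succ n ih =>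
    rw [Function.iterate_succ_apply']
    exact next_pos ih

theorem V_sub_R_vStar (D : Relay) : D.V (D.τ D.vStar) - D.R (D.τ D.vStar) = 2 * D.k := by
  have h := D.next_vStar
  rw [next] at h
  rw [V_τ D.vStar_pos]
  linarith

/-- Passing to the limit in the recursion gives V(l) - R(l) = 2k, and V - R is injective on `dom`.
-/
theorem eq_fixed_of_tendsto {u : ℕ → ℝ} {l : ℝ}
    (hV : ∀ n, D.V (u (n + 1)) = D.R (u n) + 2 * D.k)
    (hl : l ∈ D.dom) (hlim : Tendsto u atTop (𝓝 l)) : l = D.τ D.vStar := by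
  have h1 := ((hasDerivAt_V hl).continuousAt.tendsto.comp hlim).comp (tendsto_add_atTop_nat 1)
  have h2 := ((hasDerivAt_R hl).continuousAt.tendsto.comp hlim).add_const (2 * D.k)
  have h3 := tendsto_nhds_unique h1 (h2.congr fun n => (hV n).symm)
  have h4 := D.V_sub_R_vStar
  have hs := τ_mem (D := D) D.vStar_pos
  rcases lt_trichotomy l (D.τ D.vStar) with h | h | h
  · have := V_sub_R_lt hl hs h
    linarith
  · exact h
  · have := V_sub_R_lt hs hl h
    linarith

/-- Successive half periods converge to that of the limit cycle. -/
theorem tendsto_τ_iterate {v : ℝ} (hv : 0 < v) :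
    Tendsto (fun n => D.τ (D.next^[n] v)) atTop (𝓝 (D.τ D.vStar)) := by
  set u := fun n => D.τ (D.next^[n] v) with hu
  have hud : ∀ n, u n ∈ D.dom := fun n => τ_mem (iterate_pos hv n)
  have hV : ∀ n, D.V (u (n + 1)) = D.R (u n) + 2 * D.k := fun n => by
    simp only [hu]
    rw [V_τ (iterate_pos hv _), Function.iterate_succ_apply', next]
  have hs := τ_mem (D := D) D.vStar_pos
  have h4 := D.V_sub_R_vStar
  -- Since V and R increase, the recursion preserves the side of the fixed duration. On that side,
  -- monotonicity of V - R fixes the sign of V - R - 2k, hence the direction of motion.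
  rcases le_total (u 0) (D.τ D.vStar) with h0 | h0
  · have hle : ∀ n, u n ≤ D.τ D.vStar := fun n => by
      induction n with
      | zero => exact h0
      | succ n ih =>
        by_contra hcon
        have h1 := V_lt hs (hud _) (not_le.1 hcon)
        rw [hV] at h1
        rcases ih.eq_or_lt with h | h
        · rw [h] at h1
          linarith
        · have := R_lt (hud n) hs h
          linarith
    have hmono : Monotone u := monotone_nat_of_le_succ fun n => by
      by_contra hcon
      have h1 := V_lt (hud _) (hud _) (not_le.1 hcon)
      rw [hV] at h1
      rcases (hle n).eq_or_lt with h | h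
      · rw [h] at h1
        linarith
      · have := V_sub_R_lt (hud n) hs h
        linarith
    have hlim := tendsto_atTop_ciSup hmono ⟨_, by rintro _ ⟨n, rfl⟩; exact hle n⟩
    -- The limit stays inside `dom`, where V and R are continuous, as it is caught between u 0 and
    -- the fixed duration.
    have hl : (⨆ n, u n) ∈ D.dom := mem_dom_of_le hs
      ((hud 0).1.trans_le (hmono.ge_of_tendsto hlim 0)) (ciSup_le hle)
    rwa [eq_fixed_of_tendsto hV hl hlim] at hlim
  · have hle : ∀ n, D.τ D.vStar ≤ u n := fun n => by
      induction n with
      | zero => exact h0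
      | succ n ih =>
        by_contra hcon
        have h1 := V_lt (hud _) hs (not_le.1 hcon)
        rw [hV] at h1
        rcases ih.eq_or_lt with h | h
        · rw [← h] at h1
          linarith
        · have := R_lt hs (hud n) h
          linarith
    have hanti : Antitone u := antitone_nat_of_succ_le fun n => by
      by_contra hcon
      have h1 := V_lt (hud _) (hud _) (not_le.1 hcon)
      rw [hV] at h1
      rcases (hle n).eq_or_lt with h | h
      · rw [← h] at h1
        linarith
      · have := V_sub_R_lt hs (hud n) h
        linarith
    have hlim := tendsto_atTop_ciInf hanti ⟨_, by rintro _ ⟨n, rfl⟩; exact hle n⟩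
    have hl : (⨅ n, u n) ∈ D.dom := Icc_subset_dom hs (hud 0)
      ⟨le_ciInf hle, hanti.le_of_tendsto hlim 0⟩
    rwa [eq_fixed_of_tendsto hV hl hlim] at hlim

/-- Successive departure speeds converge to that of the limit cycle. -/
theorem tendsto_iterate {v : ℝ} (hv : 0 < v) :
    Tendsto (fun n => D.next^[n] v) atTop (𝓝 D.vStar) := by
  have h := (hasDerivAt_V (τ_mem (D := D) D.vStar_pos)).continuousAt.tendsto.comp
    (tendsto_τ_iterate hv)
  rw [V_τ D.vStar_pos] at h
  exact h.congr fun n => V_τ (iterate_pos hv n)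

end Relay

/-! ### Invariance of Filippov solutions under sign change and time shift -/

/-- Absolute continuity is preserved by postcomposition with a Lipschitz function. -/
theorem absolutelyContinuousOnInterval_comp {X Y : Type*} [PseudoMetricSpace X]
    [PseudoMetricSpace Y] {φ : X → Y} {K : NNReal} (hφ : LipschitzWith K φ) {f : ℝ → X} {a b : ℝ}
    (hf : AbsolutelyContinuousOnInterval f a b) :
    AbsolutelyContinuousOnInterval (fun t => φ (f t)) a b := by
  refine squeeze_zero (fun _ => Finset.sum_nonneg fun _ _ => dist_nonneg) (fun E => ?_)
    (by simpa using Tendsto.const_mul (K : ℝ) hf)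
  rw [Finset.mul_sum]
  exact Finset.sum_le_sum fun i _ => hφ.dist_le_mul _ _

/-- Absolute continuity is preserved by translations in time. -/
theorem absolutelyContinuousOnInterval_shift {X : Type*} [PseudoMetricSpace X] {f : ℝ → X}
    {a b c : ℝ} (hf : AbsolutelyContinuousOnInterval f (a + c) (b + c)) :
    AbsolutelyContinuousOnInterval (fun t => f (t + c)) a b := by
  rw [absolutelyContinuousOnInterval_iff] at hf ⊢
  intro ε hε
  obtain ⟨δ, hδ, h⟩ := hf ε hε
  refine ⟨δ, hδ, fun E hE hEδ => ?_⟩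
  have hmem : ∀ s, s ∈ uIcc a b → s + c ∈ uIcc (a + c) (b + c) := fun s hs => by
    rw [mem_uIcc] at hs ⊢
    rcases hs with h | h
    · exact Or.inl ⟨by linarith, by linarith⟩
    · exact Or.inr ⟨by linarith, by linarith⟩
  refine h (E.1, fun i => ((E.2 i).1 + c, (E.2 i).2 + c)) ⟨fun i hi => ?_, ?_⟩ (by simpa using hEδ)
  · exact ⟨hmem _ (hE.1 i hi).1, hmem _ (hE.1 i hi).2⟩
  · intro i hi j hj hij
    have := hE.2 hi hj hij
    simp only [Function.onFun, Set.disjoint_left, mem_uIoc] at this ⊢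
    intro s hs hs'
    refine this (a := s - c) ?_ ?_
    · rcases hs with h | h
      · exact Or.inl ⟨by linarith, by linarith⟩
      · exact Or.inr ⟨by linarith, by linarith⟩
    · rcases hs' with h | h
      · exact Or.inl ⟨by linarith, by linarith⟩
      · exact Or.inr ⟨by linarith, by linarith⟩

theorem neg_mem_relay {y u : ℝ} (hu : u ∈ relay y) : -u ∈ relay (-y) := by
  obtain ⟨h1, h2, h3⟩ := hu
  refine ⟨fun h => ?_, fun h => ?_, fun h => ?_⟩
  · rw [h2 (by linarith), neg_neg]
  · rw [h1 (by linarith)]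
  · have := h3 (by linarith)
    exact ⟨by linarith [this.2], by linarith [this.1]⟩

section General

variable {A : Matrix (Fin 2) (Fin 2) ℝ} {B C : Fin 2 → ℝ} {x : ℝ → Fin 2 → ℝ}

theorem neg_mem_filippovField {ξ v : Fin 2 → ℝ} (hv : v ∈ filippovField A B C ξ) :
    -v ∈ filippovField A B C (-ξ) := by
  obtain ⟨u, hu, rfl⟩ := hv
  refine ⟨-u, ?_, ?_⟩
  · rw [dotProduct_neg]
    exact neg_mem_relay hu
  · rw [Matrix.mulVec_neg, neg_smul, neg_sub, sub_neg_eq_add, neg_add_eq_sub]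

theorem IsTrajectory.neg (hx : IsTrajectory A B C x) : IsTrajectory A B C (fun t => -x t) := by
  refine ⟨fun T hT => (hx.1 T hT).neg, ?_⟩
  filter_upwards [hx.2] with t ht h0
  obtain ⟨v, hv, h⟩ := ht h0
  exact ⟨-v, neg_mem_filippovField hv, h.neg⟩

theorem IsTrajectory.shift (hx : IsTrajectory A B C x) {c : ℝ} (hc : 0 ≤ c) :
    IsTrajectory A B C (fun t => x (t + c)) := by
  refine ⟨fun T hT => absolutelyContinuousOnInterval_shift ((hx.1 (T + c) (by linarith)).mono ?_), ?_⟩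
  · rw [uIcc_of_le (by linarith), uIcc_of_le (by linarith)]
    exact Icc_subset_Icc (by linarith) le_rfl
  · have := (measurePreserving_add_right volume c).quasiMeasurePreserving.ae hx.2
    filter_upwards [this] with t ht h0
    obtain ⟨v, hv, h⟩ := ht (by linarith)
    exact ⟨v, hv, h.comp_add_const t c⟩

theorem IsTrajectory.continuousOn (hx : IsTrajectory A B C x) : ContinuousOn x (Ici 0) := by
  intro t ht
  have h0 : (0 : ℝ) ≤ t := ht
  have h := (hx.1 (t + 1) (by linarith)).continuousOn t (by
    rw [uIcc_of_le (by linarith)]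
    exact ⟨h0, by linarith⟩)
  refine h.mono_of_mem_nhdsWithin ?_
  rw [uIcc_of_le (by linarith), ← Ici_inter_Iic, inter_comm]
  exact inter_mem (mem_nhdsWithin_of_mem_nhds (Iic_mem_nhds (by linarith))) self_mem_nhdsWithin

end General

/-! ### Companion form and the flow on one side of the line -/

namespace Relay

variable (D : Relay)

/-- The state matrix in companion form. -/
def stateMatrix : Matrix (Fin 2) (Fin 2) ℝ := !![0, 1; -D.b, -D.a]

/-- The input vector in companion form. -/
def input : Fin 2 → ℝ := ![-D.k, D.b * D.g + D.a * D.k]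

/-- The output vector in companion form. -/
def output (_ : Relay) : Fin 2 → ℝ := ![1, 0]

/-- Trajectories of the system in companion form. -/
abbrev Traj (x : ℝ → Fin 2 → ℝ) : Prop := IsTrajectory D.stateMatrix D.input D.output x

theorem output_dotProduct (ξ : Fin 2 → ℝ) : D.output ⬝ᵥ ξ = ξ 0 := by
  simp [output, dotProduct, Fin.sum_univ_two]

theorem mem_field_iff {ξ v : Fin 2 → ℝ} :
    v ∈ filippovField D.stateMatrix D.input D.output ξ ↔ ∃ u ∈ relay (ξ 0),
      v 0 = ξ 1 + D.k * u ∧ v 1 = -D.b * ξ 0 - D.a * ξ 1 - u * (D.b * D.g + D.a * D.k) := by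
  simp only [filippovField, mem_ofPred_eq, D.output_dotProduct]
  refine exists_congr fun u => and_congr_right fun _ => ?_
  constructor
  · rintro rfl
    simp [stateMatrix, input, dotProduct, Fin.sum_univ_two]
    constructor <;> ring
  · rintro ⟨h0, h1⟩
    ext i
    fin_cases i
    · simp [stateMatrix, input, dotProduct, Fin.sum_univ_two, h0]
      ring
    · simp [stateMatrix, input, dotProduct, Fin.sum_univ_two, h1]
      ring

variable {D} {x : ℝ → Fin 2 → ℝ}

theorem Traj.ac (hx : D.Traj x) (i : Fin 2) {T : ℝ} (hT : 0 < T) :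
    AbsolutelyContinuousOnInterval (fun t => x t i) 0 T := by
  have h : LipschitzWith 1 fun ξ : Fin 2 → ℝ => ξ i := LipschitzWith.eval i
  exact absolutelyContinuousOnInterval_comp h (hx.absolutelyContinuous T hT)

theorem Traj.continuousOn_apply (hx : D.Traj x) (i : Fin 2) :
    ContinuousOn (fun t => x t i) (Ici 0) :=
  (continuous_apply i).comp_continuousOn hx.continuousOn

theorem Traj.ae_hasDerivAt (hx : D.Traj x) : ∀ᵐ t : ℝ, 0 < t → ∃ u ∈ relay (x t 0),
    HasDerivAt (fun t => x t 0) (x t 1 + D.k * u) t ∧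
    HasDerivAt (fun t => x t 1)
      (-D.b * x t 0 - D.a * x t 1 - u * (D.b * D.g + D.a * D.k)) t := by
  filter_upwards [hx.2] with t ht h0
  obtain ⟨v, hv, h⟩ := ht h0
  obtain ⟨u, hu, e0, e1⟩ := D.mem_field_iff.1 hv
  have h' := hasDerivAt_pi.1 h
  exact ⟨u, hu, e0 ▸ h' 0, e1 ▸ h' 1⟩

/-- The flow of `ẋ = A x - B`, in terms of the initial displacement `(η, w)` from its
equilibrium. -/
def flow (D : Relay) (η w t : ℝ) : Fin 2 → ℝ :=
  ![D.α t * η + D.β t * w - D.g, -D.b * D.β t * η + D.γ t * w - D.k]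

@[simp] theorem flow_apply_zero (η w t : ℝ) :
    D.flow η w t 0 = D.α t * η + D.β t * w - D.g := rfl

@[simp] theorem flow_apply_one (η w t : ℝ) :
    D.flow η w t 1 = -D.b * D.β t * η + D.γ t * w - D.k := rfl

theorem flow_zero (η w : ℝ) : D.flow η w 0 = ![η - D.g, w - D.k] := by
  simp [flow, D.α_zero, D.β_zero, D.γ_zero]

theorem hasDerivAt_flow_zero (η w t : ℝ) :
    HasDerivAt (fun t => D.flow η w t 0) (D.flow η w t 1 + D.k) t := by
  refine ((((D.hasDerivAt_α t).mul_const η).add ((D.hasDerivAt_β t).mul_const w)).sub_const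
    D.g).congr_deriv ?_
  simp only [flow_apply_one]
  ring

theorem hasDerivAt_flow_one (η w t : ℝ) :
    HasDerivAt (fun t => D.flow η w t 1) (-D.b * (D.flow η w t 0 + D.g)
      - D.a * (D.flow η w t 1 + D.k)) t := by
  refine (((((D.hasDerivAt_β t).const_mul (-D.b)).mul_const η).add
    ((D.hasDerivAt_γ t).mul_const w)).sub_const D.k).congr_deriv ?_
  simp only [flow_apply_one, flow_apply_zero, α]
  ring

theorem continuous_flow_apply (η w : ℝ) (i : Fin 2) : Continuous fun t => D.flow η w t i := by
  fin_cases i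
  · exact continuous_iff_continuousAt.2 fun t => (hasDerivAt_flow_zero η w t).continuousAt
  · exact continuous_iff_continuousAt.2 fun t => (hasDerivAt_flow_one η w t).continuousAt

theorem ac_of_continuous_deriv {f f' : ℝ → ℝ} (hf : ∀ t, HasDerivAt f (f' t) t)
    (hf' : Continuous f') (a b : ℝ) : AbsolutelyContinuousOnInterval f a b := by
  have : ContDiff ℝ 1 f := contDiff_one_iff_deriv.2
    ⟨fun t => (hf t).differentiableAt, by rwa [show deriv f = f' from funext fun t => (hf t).deriv]⟩
  exact this.contDiffOn.absolutelyContinuousOnInterval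

/-- An absolutely continuous function on `[0, T]` whose derivative vanishes almost everywhere keeps
its initial value. -/
theorem eq_initial_of_ae_deriv_zero {f : ℝ → ℝ} {T : ℝ} (hT : 0 < T)
    (hf : AbsolutelyContinuousOnInterval f 0 T)
    (h : ∀ᵐ t : ℝ, t ∈ Ioo 0 T → HasDerivAt f 0 t) : ∀ t ∈ Icc 0 T, f t = f 0 := by
  obtain ⟨c, hc⟩ := hf.const_of_ae_hasDerivAt_zero (by
    filter_upwards [h, Measure.ae_ne volume 0, Measure.ae_ne volume T] with t ht h0 hT' hmem
    rw [uIcc_of_le hT.le] at hmem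
    exact ht ⟨lt_of_le_of_ne hmem.1 (Ne.symm h0), lt_of_le_of_ne hmem.2 hT'⟩)
  rw [uIcc_of_le hT.le] at hc
  intro t ht
  rw [hc t ht, hc 0 ⟨le_rfl, hT.le⟩]

/-- While the output is positive a trajectory follows the flow. -/
theorem Traj.eq_flow_of_pos (hx : D.Traj x) {T : ℝ} (hT : 0 < T)
    (hpos : ∀ t ∈ Ioo 0 T, 0 < x t 0) :
    ∀ t ∈ Icc 0 T, x t = D.flow (x 0 0 + D.g) (x 0 1 + D.k) t := by
  have hE := ac_of_continuous_deriv D.hasDerivAt_exp (by fun_prop) 0 T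
  have hβ := ac_of_continuous_deriv D.hasDerivAt_β D.continuous_γ 0 T
  have hγ := ac_of_continuous_deriv D.hasDerivAt_γ
    ((D.continuous_γ.const_mul _).sub (D.continuous_β.const_mul _)) 0 T
  have hα := ac_of_continuous_deriv D.hasDerivAt_α (D.continuous_β.const_mul _) 0 T
  have hc : ∀ c : ℝ, AbsolutelyContinuousOnInterval (fun _ => c) 0 T := fun c =>
    ac_of_continuous_deriv (fun t => hasDerivAt_const t c) continuous_const 0 T
  have hη := (Traj.ac hx 0 hT).fun_add (hc D.g)
  have hw := (Traj.ac hx 1 hT).fun_add (hc D.k)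
  have hder : ∀ᵐ t : ℝ, t ∈ Ioo 0 T →
      HasDerivAt (fun t => x t 0 + D.g) (x t 1 + D.k) t ∧
      HasDerivAt (fun t => x t 1 + D.k) (-D.b * (x t 0 + D.g) - D.a * (x t 1 + D.k)) t := by
    filter_upwards [Traj.ae_hasDerivAt hx] with t ht hmem
    obtain ⟨u, hu, h0, h1⟩ := ht hmem.1
    rw [hu.1 (hpos t hmem)] at h0 h1
    exact ⟨(h0.add_const _).congr_deriv (by ring), (h1.add_const _).congr_deriv (by ring)⟩
  -- `e1` and `e2` express that the inverse fundamental matrix, exp(a t) times the adjugate of (α,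
  -- β; -bβ, γ), carries the displacement back to its initial value. Absolute continuity allows this
  -- to be checked almost everywhere.
  have e1 := eq_initial_of_ae_deriv_zero hT (hE.fun_mul ((hγ.fun_mul hη).fun_sub (hβ.fun_mul hw))) (by
    filter_upwards [hder] with t ht hmem
    obtain ⟨h0, h1⟩ := ht hmem
    exact ((D.hasDerivAt_exp t).fun_mul (((D.hasDerivAt_γ t).fun_mul h0).fun_sub
      ((D.hasDerivAt_β t).fun_mul h1))).congr_deriv (by ring))
  have e2 := eq_initial_of_ae_deriv_zero hT
    (hE.fun_mul (((hβ.const_mul D.b).fun_mul hη).fun_add (hα.fun_mul hw))) (by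
    filter_upwards [hder] with t ht hmem
    obtain ⟨h0, h1⟩ := ht hmem
    exact ((D.hasDerivAt_exp t).fun_mul ((((D.hasDerivAt_β t).const_mul D.b).fun_mul h0).fun_add
      ((D.hasDerivAt_α t).fun_mul h1))).congr_deriv (by simp only [α]; ring))
  intro t ht
  have e1 := e1 t ht
  have e2 := e2 t ht
  have hW := D.exp_mul_wronskian t
  simp only [D.β_zero, D.γ_zero, D.α_zero, mul_zero, Real.exp_zero, one_mul, zero_mul, sub_zero,
    zero_add] at e1 e2
  ext i
  fin_cases i
  · simp only [Fin.zero_eta, flow_apply_zero]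
    linear_combination D.α t * e1 + D.β t * e2 - (x t 0 + D.g) * hW
  · simp only [Fin.mk_one, flow_apply_one]
    linear_combination -D.b * D.β t * e1 + D.γ t * e2 - (x t 1 + D.k) * hW

/-- A trajectory that starts into the positive half plane follows the flow as long as the flow stays
there. -/
theorem Traj.eq_flow (hx : D.Traj x) {ε T : ℝ} (hε : 0 < ε) (hT : 0 < T)
    (hpos : ∀ t ∈ Ioo 0 ε, 0 < x t 0)
    (hflow : ∀ t ∈ Ioo 0 T, 0 < D.flow (x 0 0 + D.g) (x 0 1 + D.k) t 0) :
    ∀ t ∈ Icc 0 T, x t = D.flow (x 0 0 + D.g) (x 0 1 + D.k) t := by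
  refine Traj.eq_flow_of_pos hx hT fun t ht => ?_
  by_contra hcon
  -- Start the search for a first zero r inside the interval where positivity is known. Up to r the
  -- trajectory is the flow, which is still positive at r.
  have hs : 0 < min ε t / 2 := half_pos (lt_min hε ht.1)
  have hs' : min ε t / 2 < min ε t := half_lt_self (lt_min hε ht.1)
  have hsε := hs'.trans_le (min_le_left _ _)
  have hst := hs'.trans_le (min_le_right _ _)
  obtain ⟨r, hr, hr0, hlt⟩ := exists_first_hit (f := fun t => x t 0) hst.le
    ((Traj.continuousOn_apply hx 0).mono fun q hq => hs.le.trans hq.1) (hpos _ ⟨hs, hsε⟩)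
    (not_lt.1 hcon)
  have hr' : 0 < r := hs.trans hr.1
  have := Traj.eq_flow_of_pos hx hr' (fun q hq => by
    rcases lt_or_ge q (min ε t / 2) with h | h
    · exact hpos q ⟨hq.1, h.trans hsε⟩
    · exact hlt q ⟨h, hq.2⟩) r ⟨hr'.le, le_rfl⟩
  have h2 := hflow r ⟨hr', hr.2.trans_lt ht.2⟩
  rw [← this, hr0] at h2
  exact lt_irrefl _ h2

/-! ### Leaving the switching line and returning to it -/

/-- A trajectory that stays on the switching line forever is the equilibrium. -/
theorem Traj.eq_zero (hx : D.Traj x) (h0 : ∀ t, 0 ≤ t → x t 0 = 0) : ∀ t, 0 ≤ t → x t = 0 := by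
  -- The zero of the transfer function, which is the rate of the sliding dynamics.
  set z := D.b * D.g / D.k with hz
  have hkz : D.k * z = D.b * D.g := by
    have := D.k_pos
    rw [hz]
    field_simp
  have hzpos : 0 < z := div_pos (mul_pos D.b_pos D.g_pos) D.k_pos
  have hder : ∀ᵐ t : ℝ, 0 < t → |x t 1| ≤ D.k ∧ HasDerivAt (fun t => x t 1) (z * x t 1) t := by
    filter_upwards [Traj.ae_hasDerivAt hx] with t ht hpos
    obtain ⟨u, hu, d0, d1⟩ := ht hpos
    have hzero : HasDerivAt (fun t => x t 0) 0 t := by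
      refine (hasDerivAt_const t (0 : ℝ)).congr_of_eventuallyEq ?_
      filter_upwards [Ioi_mem_nhds hpos] with s hs
      exact h0 s (le_of_lt hs)
    have hu1 := d0.unique hzero
    have hp : x t 1 = -(D.k * u) := by linarith
    have hub := abs_le.2 (hu.2.2 (h0 t hpos.le))
    refine ⟨?_, d1.congr_deriv ?_⟩
    · rw [hp, abs_neg, abs_mul, abs_of_pos D.k_pos]
      have := D.k_pos
      nlinarith
    · rw [h0 t hpos.le, hp]
      linear_combination u * hkz
  have hexp : ∀ t : ℝ, HasDerivAt (fun t => Real.exp (-z * t)) (-z * Real.exp (-z * t)) t := fun t => by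
    have := ((hasDerivAt_id t).const_mul (-z)).exp
    simpa [mul_comm] using this
  have hsol : ∀ t, 0 < t → Real.exp (-z * t) * x t 1 = x 0 1 := fun t ht => by
    have := eq_initial_of_ae_deriv_zero ht
      ((ac_of_continuous_deriv hexp (by fun_prop) 0 t).fun_mul (Traj.ac hx 1 ht)) (by
        filter_upwards [hder] with s hs hmem
        exact ((hexp s).fun_mul (hs hmem.1).2).congr_deriv (by ring)) t ⟨ht.le, le_rfl⟩
    simpa using this
  -- Sliding needs |p| ≤ k, whereas a nonzero p grows like exp(z t).
  have hp0 : x 0 1 = 0 := by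
    by_contra hne
    have hlim : Tendsto (fun t : ℝ => Real.exp (-z * t) * D.k) atTop (𝓝 0) := by
      simpa using (Real.tendsto_exp_atBot.comp
        (tendsto_id.const_mul_atTop_of_neg (neg_lt_zero.2 hzpos))).mul_const D.k
    obtain ⟨N, hN⟩ := eventually_atTop.1 (hlim.eventually (gt_mem_nhds (abs_pos.2 hne)))
    obtain ⟨t, hbd, ht⟩ := (Measure.dense_of_ae hder).exists_gt (max N 0)
    have ht0 : 0 < t := (le_max_right _ _).trans_lt ht
    have h1 := (hbd ht0).1
    have h2 := hN t ((le_max_left _ _).trans ht.le)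
    rw [← hsol t ht0, abs_mul, abs_of_pos (Real.exp_pos _)] at h2
    have := lt_of_mul_lt_mul_left h2 (Real.exp_pos _).le
    linarith
  intro t ht
  have h1 : x t 1 = 0 := by
    rcases ht.eq_or_lt with h | h
    · rw [← h, hp0]
    · have := hsol t h
      rw [hp0] at this
      exact (mul_eq_zero.1 this).resolve_left (Real.exp_pos _).ne'
  ext i
  fin_cases i
  · exact h0 t ht
  · exact h1

/-- Beyond the sliding segment the switching line is crossed at once. -/
theorem Traj.pos_of_crossing (hx : D.Traj x) (h0 : x 0 0 = 0) (h1 : D.k < x 0 1) :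
    ∃ ε > 0, ∀ t ∈ Ioo 0 ε, 0 < x t 0 := by
  -- While p > k + c, every admissible relay value gives ẏ = p + k u > c; integrating gives y ≥ c t.
  set c := (x 0 1 - D.k) / 2 with hc
  have hcpos : 0 < c := by linarith
  have hcont := Traj.continuousOn_apply hx 1 0 self_mem_Ici
  have hev := hcont.eventually (lt_mem_nhds (show D.k + c < x 0 1 by linarith))
  obtain ⟨ε, hε, hev⟩ := Metric.eventually_nhds_iff.1 (eventually_nhdsWithin_iff.1 hev)
  refine ⟨ε, hε, fun t ht => ?_⟩
  have hac : AbsolutelyContinuousOnInterval (fun t => x t 0 - c * t) 0 t :=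
    (Traj.ac hx 0 ht.1).fun_sub (ac_of_continuous_deriv
      (fun s => ((hasDerivAt_id s).const_mul c)) continuous_const 0 t)
  have hint := hac.integral_deriv_eq_sub
  have hnn : 0 ≤ ∫ s in (0 : ℝ)..t, deriv (fun t => x t 0 - c * t) s := by
    refine intervalIntegral.integral_nonneg_of_ae_restrict ht.1.le ?_
    rw [EventuallyLE, ae_restrict_iff' measurableSet_Icc]
    filter_upwards [Traj.ae_hasDerivAt hx, Measure.ae_ne volume 0] with s hs hs0 hmem
    have hspos := lt_of_le_of_ne hmem.1 (Ne.symm hs0)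
    obtain ⟨u, hu, d0, -⟩ := hs hspos
    have hd := (d0.fun_sub ((hasDerivAt_id s).const_mul c)).deriv
    have hp := hev (by
      rw [Real.dist_eq, sub_zero, abs_of_pos hspos]
      exact hmem.2.trans_lt ht.2) hspos.le
    have hu1 : -1 ≤ u := by
      rcases lt_trichotomy (x s 0) 0 with h | h | h
      · exact (hu.2.1 h).ge
      · exact (hu.2.2 h).1
      · rw [hu.1 h]
        norm_num
    simp only [id] at hd
    rw [Pi.zero_apply, hd]
    have := mul_le_mul_of_nonneg_left hu1 D.k_pos.le
    linarith
  rw [hint] at hnn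
  have := mul_pos hcpos ht.1
  simp only [h0, mul_zero, sub_zero] at hnn
  linarith

/-- For fixed t the output is affine in v with slope β(t) and root V(t). Its sign is thus decided by
comparing v with V(t), and since V increases there is no return before `τ v`. -/
theorem flow_output_eq {v t : ℝ} (ht : t ∈ D.dom) :
    D.flow D.g v t 0 = D.β t * (v - D.V t) := by
  have := (β_pos ht).ne'
  simp only [flow_apply_zero, V]
  field_simp
  ring

theorem flow_output_pos {v t : ℝ} (hv : 0 < v) (ht : t ∈ Ioo 0 (D.τ v)) :
    0 < D.flow D.g v t 0 := by
  have hτ := τ_mem (D := D) hv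
  have htd := mem_dom_of_le hτ ht.1 ht.2.le
  rw [flow_output_eq htd]
  have := V_lt htd hτ ht.2
  rw [V_τ hv] at this
  exact mul_pos (β_pos htd) (by linarith)

theorem flow_start (v : ℝ) : D.flow D.g v 0 = ![0, v - D.k] := by
  rw [flow_zero, sub_self]

/-- The state at the end of a half cycle is opposite to the start of the next one. -/
theorem flow_τ {v : ℝ} (hv : 0 < v) : D.flow D.g v (D.τ v) = -D.flow D.g (D.next v) 0 := by
  have hτ := τ_mem (D := D) hv
  have h0 : D.flow D.g v (D.τ v) 0 = 0 := by
    rw [flow_output_eq hτ, V_τ hv, sub_self, mul_zero]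
  -- The arrival velocity is -R, so p = -R - k. The coordinate p is continuous across the line,
  -- where ẏ changes from p + k to p - k; this produces the 2k in `next`.
  have h1 : D.flow D.g v (D.τ v) 1 = -(D.next v - D.k) := by
    have hW := D.wronskian (D.τ v)
    have hβ := (β_pos hτ).ne'
    have hVv := V_τ (D := D) hv
    rw [flow_apply_one, next, R, ← hW]
    rw [V, div_eq_iff hβ] at hVv
    field_simp
    linear_combination -D.γ (D.τ v) * hVv
  rw [flow_start]
  ext i
  fin_cases i
  · simpa using h0
  · simpa using h1

/-- A trajectory that starts on the switching line beyond the sliding segment follows the flow for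
a half cycle. -/
theorem Traj.eq_flow_half (hx : D.Traj x) (h0 : x 0 0 = 0) (h1 : D.k < x 0 1) :
    ∀ t ∈ Icc 0 (D.τ (x 0 1 + D.k)), x t = D.flow D.g (x 0 1 + D.k) t := by
  have hv : 0 < x 0 1 + D.k := by linarith [D.k_pos]
  obtain ⟨ε, hε, hpos⟩ := Traj.pos_of_crossing hx h0 h1
  have := Traj.eq_flow hx hε (τ_mem (D := D) hv).1 hpos (fun t ht => by
    rw [h0, zero_add]
    exact flow_output_pos hv ht)
  rwa [h0, zero_add] at this

/-- From the open positive half plane the flow reaches the switching line, transversally and beyond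
the sliding segment. -/
theorem exists_flow_hit (D : Relay) {η w : ℝ} (hη : D.g < η) :
    ∃ T > 0, D.flow η w T 0 = 0 ∧ D.flow η w T 1 < -D.k ∧ ∀ t ∈ Ico 0 T, 0 < D.flow η w t 0 := by
  have hlim : Tendsto (fun t => D.flow η w t 0) atTop (𝓝 (-D.g)) := by
    have := ((D.tendsto_α.mul_const η).add (D.tendsto_β.mul_const w)).sub_const D.g
    simpa using this
  obtain ⟨N, hN⟩ := eventually_atTop.1
    (hlim.eventually (gt_mem_nhds (neg_lt_zero.2 D.g_pos)))
  have hs : 0 < D.flow η w 0 0 := by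
    simp [D.α_zero, D.β_zero, hη]
  obtain ⟨T, hT, hT0, hlt⟩ := exists_first_hit (le_max_right N 0)
    (continuous_flow_apply (D := D) η w 0).continuousOn hs (hN _ (le_max_left N 0)).le
  refine ⟨T, hT.1, hT0, ?_, hlt⟩
  -- Were ẏ(T) ≥ 0, then, since exp(a t) ẏ decreases while y > -g, ẏ would be positive before T, and
  -- y could not fall from y(0) > 0 to 0.
  by_contra hcon
  have hw : 0 ≤ D.flow η w T 1 + D.k := by linarith [not_lt.1 hcon]
  have hηpos : ∀ t ∈ Icc 0 T, 0 < D.flow η w t 0 + D.g := fun t ht => by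
    have := D.g_pos
    rcases ht.2.eq_or_lt with h | h
    · rw [h, hT0]
      linarith
    · linarith [hlt t ⟨ht.1, h⟩]
  have hwpos : ∀ t ∈ Ioo 0 T, 0 < D.flow η w t 1 + D.k := fun t ht => by
    have := lt_of_hasDerivAt_pos
      (f := fun t => -(Real.exp (D.a * t) * (D.flow η w t 1 + D.k)))
      (f' := fun t => Real.exp (D.a * t) * (D.b * (D.flow η w t 0 + D.g))) ht.2
      (fun s _ => ((D.hasDerivAt_exp s).fun_mul
        ((hasDerivAt_flow_one η w s).add_const D.k)).fun_neg.congr_deriv (by ring))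
      (fun s hs => mul_pos (Real.exp_pos _) (mul_pos D.b_pos
        (hηpos s ⟨(ht.1.trans hs.1).le, hs.2.le⟩)))
    have h2 := mul_nonneg (Real.exp_pos (D.a * T)).le hw
    have h3 : 0 < Real.exp (D.a * t) * (D.flow η w t 1 + D.k) := by linarith
    exact pos_of_mul_pos_right h3 (Real.exp_pos _).le
  have := lt_of_hasDerivAt_pos hT.1 (fun s _ => hasDerivAt_flow_zero (D := D) η w s) hwpos
  linarith

/-- From the open positive half plane every trajectory reaches the switching line beyond the sliding
segment. -/
theorem Traj.exists_hit (hx : D.Traj x) (h0 : 0 < x 0 0) :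
    ∃ T > 0, x T 0 = 0 ∧ x T 1 < -D.k := by
  obtain ⟨T, hT, hT0, hT1, hpos⟩ := D.exists_flow_hit (η := x 0 0 + D.g) (w := x 0 1 + D.k)
    (by linarith)
  have hev := (Traj.continuousOn_apply hx 0 0 self_mem_Ici).eventually (lt_mem_nhds h0)
  obtain ⟨ε, hε, hev⟩ := Metric.eventually_nhds_iff.1 (eventually_nhdsWithin_iff.1 hev)
  have := Traj.eq_flow hx hε hT (fun t ht => hev (by
    rw [Real.dist_eq, sub_zero, abs_of_pos ht.1]
    exact ht.2) ht.1.le) (fun t ht => hpos t ⟨ht.1.le, ht.2⟩) T ⟨hT.le, le_rfl⟩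
  exact ⟨T, hT, by rw [this, hT0], by rw [this]; exact hT1⟩

/-- Every trajectory other than the equilibrium crosses the switching line beyond the sliding
segment. -/
theorem Traj.exists_crossing (hx : D.Traj x) (hne : ∃ t, 0 ≤ t ∧ x t ≠ 0) :
    ∃ T, 0 ≤ T ∧ x T 0 = 0 ∧ D.k < |x T 1| := by
  have : ∃ t, 0 ≤ t ∧ x t 0 ≠ 0 := by
    by_contra! hcon
    obtain ⟨t, ht, h⟩ := hne
    exact h (Traj.eq_zero hx hcon t ht)
  obtain ⟨s, hs, hs0⟩ := this
  rcases lt_or_gt_of_ne hs0 with h | h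
  · obtain ⟨T, hT, h0, h1⟩ := Traj.exists_hit (hx.shift hs).neg (by simpa using h)
    refine ⟨T + s, by linarith, by simpa using h0, ?_⟩
    simp only [Pi.neg_apply] at h1
    exact lt_of_lt_of_le (by linarith) (le_abs_self _)
  · obtain ⟨T, hT, h0, h1⟩ := Traj.exists_hit (hx.shift hs) (by simpa using h)
    refine ⟨T + s, by linarith, h0, ?_⟩
    exact lt_of_lt_of_le (by linarith) (neg_le_abs _)

end Relay

/-! ### Concatenating half cycles into trajectories -/

theorem lipschitzOnWith_join {X : Type*} [PseudoMetricSpace X] {f : ℝ → X} {a b c : ℝ}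
    {K L : NNReal} (hf : LipschitzOnWith K f (Icc a b)) (hg : LipschitzOnWith L f (Icc b c)) :
    LipschitzOnWith (max K L) f (Icc a c) := by
  have key : ∀ s ∈ Icc a c, ∀ t ∈ Icc a c, s ≤ t → dist (f s) (f t) ≤ (max K L : NNReal) * dist s t := by
    intro s hs t ht hst
    have hK : (K : ℝ) ≤ (max K L : NNReal) := NNReal.coe_le_coe.2 (le_max_left _ _)
    have hL : (L : ℝ) ≤ (max K L : NNReal) := NNReal.coe_le_coe.2 (le_max_right _ _)
    rcases le_total t b with htb | htb
    · refine (hf.dist_le_mul s ⟨hs.1, hst.trans htb⟩ t ⟨ht.1, htb⟩).trans ?_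
      gcongr
    rcases le_total s b with hsb | hsb
    · have h1 := hf.dist_le_mul s ⟨hs.1, hsb⟩ b ⟨hs.1.trans hsb, le_rfl⟩
      have h2 := hg.dist_le_mul b ⟨le_rfl, htb.trans ht.2⟩ t ⟨htb, ht.2⟩
      have h3 : dist s t = dist s b + dist b t := by
        rw [dist_comm s t, dist_comm s b, dist_comm b t, Real.dist_eq, Real.dist_eq, Real.dist_eq,
          abs_of_nonneg (by linarith), abs_of_nonneg (by linarith), abs_of_nonneg (by linarith)]
        ring
      calc dist (f s) (f t) ≤ dist (f s) (f b) + dist (f b) (f t) := dist_triangle _ _ _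
        _ ≤ K * dist s b + L * dist b t := add_le_add h1 h2
        _ ≤ (max K L : NNReal) * dist s b + (max K L : NNReal) * dist b t := by gcongr
        _ = _ := by rw [h3]; ring
    · refine (hg.dist_le_mul s ⟨hsb, hs.2⟩ t ⟨htb, ht.2⟩).trans ?_
      gcongr
  refine LipschitzOnWith.of_dist_le_mul fun s hs t ht => ?_
  rcases le_total s t with h | h
  · exact key s hs t ht h
  · rw [dist_comm, dist_comm s t]
    exact key t ht s hs h

/-- A function that is made up of smooth pieces of trajectories is a trajectory. -/
theorem isTrajectory_of_pieces {A : Matrix (Fin 2) (Fin 2) ℝ} {B C : Fin 2 → ℝ}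
    {x : ℝ → Fin 2 → ℝ} {s : ℕ → ℝ} (hs0 : s 0 = 0)
    (hlim : Tendsto s atTop atTop)
    (hlip : ∀ n, ∃ K, LipschitzOnWith K x (Icc (s n) (s (n + 1))))
    (hder : ∀ n, ∀ t ∈ Ioo (s n) (s (n + 1)), ∃ v ∈ filippovField A B C (x t), HasDerivAt x v t) :
    IsTrajectory A B C x := by
  have hlip' : ∀ n, ∃ K, LipschitzOnWith K x (Icc 0 (s n)) := fun n => by
    induction n with
    | zero =>
      refine ⟨0, LipschitzOnWith.of_dist_le_mul fun t ht r hr => ?_⟩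
      rw [hs0] at ht hr
      rw [le_antisymm ht.2 ht.1, le_antisymm hr.2 hr.1]
      simp
    | succ n ih =>
      obtain ⟨K, hK⟩ := ih
      obtain ⟨L, hL⟩ := hlip n
      exact ⟨_, lipschitzOnWith_join hK hL⟩
  refine ⟨fun T hT => ?_, ?_⟩
  · obtain ⟨n, hn⟩ := (hlim.eventually_ge_atTop T).exists
    obtain ⟨K, hK⟩ := hlip' n
    refine (hK.mono ?_).absolutelyContinuousOnInterval
    rw [uIcc_of_le hT.le]
    exact Icc_subset_Icc_right hn
  -- Switching times form a null set; for any other t, the least index with t < s N identifies the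
  -- open piece containing t.
  · filter_upwards [(countable_range s).ae_notMem volume] with t ht h0
    have hex : ∃ n, t < s n := (hlim.eventually_gt_atTop t).exists
    classical
    have hfind := Nat.find_spec hex
    have hmin := fun m => Nat.find_min (H := hex) (m := m)
    generalize Nat.find hex = N at hfind hmin
    cases N with
    | zero => rw [hs0] at hfind; linarith
    | succ n =>
      refine hder n t ⟨lt_of_le_of_ne (not_lt.1 (hmin n (Nat.lt_succ_self n))) fun h => ?_, hfind⟩
      exact ht ⟨n, h⟩

namespace Relay

variable {D : Relay} {x : ℝ → Fin 2 → ℝ}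

/-- The switching times of the solution that leaves the switching line at speed `v`. -/
noncomputable def time (D : Relay) (v : ℝ) (n : ℕ) : ℝ :=
  ∑ i ∈ Finset.range n, D.τ (D.next^[i] v)

theorem time_zero (v : ℝ) : D.time v 0 = 0 := by simp [time]

theorem time_succ (v : ℝ) (n : ℕ) : D.time v (n + 1) = D.time v n + D.τ (D.next^[n] v) :=
  Finset.sum_range_succ _ _

theorem time_succ' (v : ℝ) (n : ℕ) : D.time v (n + 1) = D.time (D.next v) n + D.τ v := by
  simp [time, Finset.sum_range_succ']

theorem time_strictMono {v : ℝ} (hv : 0 < v) : StrictMono (D.time v) :=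
  strictMono_nat_of_lt_succ fun n => by
    rw [time_succ]
    linarith [(τ_mem (D := D) (iterate_pos (D := D) hv n)).1]

/-- Switching times do not accumulate: the durations tend to a positive limit, so they are not
summable. -/
theorem tendsto_time {v : ℝ} (hv : 0 < v) : Tendsto (D.time v) atTop atTop := by
  refine (not_summable_iff_tendsto_nat_atTop_of_nonneg
    fun n => (τ_mem (D := D) (iterate_pos hv n)).1.le).1 fun h => ?_
  have := tendsto_nhds_unique h.tendsto_atTop_zero (tendsto_τ_iterate hv)
  exact (τ_mem (D := D) D.vStar_pos).1.ne this

theorem exists_time_index {v t : ℝ} (hv : 0 < v) (ht : 0 ≤ t) :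
    ∃ n, t ∈ Ico (D.time v n) (D.time v (n + 1)) := by
  have hex : ∃ n, t < D.time v n := ((tendsto_time hv).eventually_gt_atTop t).exists
  classical
  have hfind := Nat.find_spec hex
  have hmin := fun m => Nat.find_min (H := hex) (m := m)
  generalize Nat.find hex = N at hfind hmin
  cases N with
  | zero => rw [time_zero] at hfind; linarith
  | succ n => exact ⟨n, not_lt.1 (hmin n (Nat.lt_succ_self n)), hfind⟩

/-- `x` is the solution that leaves the switching line at speed `v` into the positive half plane
and crosses the line after each half cycle. -/
def Follows (D : Relay) (v : ℝ) (x : ℝ → Fin 2 → ℝ) : Prop :=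
  ∀ n, ∀ t ∈ Icc (D.time v n) (D.time v (n + 1)),
    x t = (-1 : ℝ) ^ n • D.flow D.g (D.next^[n] v) (t - D.time v n)

theorem Follows.eq {v : ℝ} (hv : 0 < v) {y : ℝ → Fin 2 → ℝ} (hx : D.Follows v x)
    (hy : D.Follows v y) {t : ℝ} (ht : 0 ≤ t) : x t = y t := by
  obtain ⟨n, hn⟩ := exists_time_index (D := D) hv ht
  rw [hx n t ⟨hn.1, hn.2.le⟩, hy n t ⟨hn.1, hn.2.le⟩]

theorem Follows.initial {v : ℝ} (hv : 0 < v) (hx : D.Follows v x) : x 0 = ![0, v - D.k] := by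
  have h := hx 0 0 (by
    rw [time_succ, time_zero, zero_add]
    exact ⟨le_rfl, (τ_mem (D := D) hv).1.le⟩)
  rw [h, time_zero]
  simp [flow_start]

theorem exists_follows (D : Relay) {v : ℝ} (hv : 0 < v) : ∃ x, D.Follows v x := by
  classical
  refine ⟨fun t => if h : ∃ n, t ∈ Ico (D.time v n) (D.time v (n + 1)) then
    (-1 : ℝ) ^ h.choose • D.flow D.g (D.next^[h.choose] v) (t - D.time v h.choose) else 0, ?_⟩
  have huniq : ∀ m n t, t ∈ Ico (D.time v m) (D.time v (m + 1)) →
      t ∈ Ico (D.time v n) (D.time v (n + 1)) → m ≤ n := fun m n t hm hn =>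
    Nat.lt_succ_iff.1 ((time_strictMono (D := D) hv).lt_iff_lt.1 (hm.1.trans_lt hn.2))
  have hval : ∀ n t, t ∈ Ico (D.time v n) (D.time v (n + 1)) →
      (if h : ∃ n, t ∈ Ico (D.time v n) (D.time v (n + 1)) then
        (-1 : ℝ) ^ h.choose • D.flow D.g (D.next^[h.choose] v) (t - D.time v h.choose) else 0)
      = (-1 : ℝ) ^ n • D.flow D.g (D.next^[n] v) (t - D.time v n) := fun n t hn => by
    have h : ∃ n, t ∈ Ico (D.time v n) (D.time v (n + 1)) := ⟨n, hn⟩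
    rw [dif_pos h, le_antisymm (huniq _ _ t h.choose_spec hn) (huniq _ _ t hn h.choose_spec)]
  intro n t ht
  rcases ht.2.lt_or_eq with h | h
  · exact hval n t ⟨ht.1, h⟩
  -- At a switching time the definition uses the next piece; `flow_τ` shows that both pieces agree
  -- there.
  · refine (hval (n + 1) t ⟨h.ge, h ▸ time_strictMono hv (Nat.lt_succ_self _)⟩).trans ?_
    have e1 : t - D.time v (n + 1) = 0 := by linarith
    have e2 : t - D.time v n = D.τ (D.next^[n] v) := by
      rw [h, time_succ]
      ring
    rw [e1, e2, flow_τ (iterate_pos hv n), Function.iterate_succ_apply', pow_succ, smul_neg,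
      mul_neg_one, neg_smul]

/-- A trajectory that starts beyond the sliding segment is determined by its initial state. -/
theorem Traj.follows (hx : D.Traj x) (h0 : x 0 0 = 0) (h1 : D.k < x 0 1) :
    D.Follows (x 0 1 + D.k) x := by
  intro n
  induction n generalizing x with
  | zero =>
    intro t ht
    rw [time_succ, time_zero, zero_add] at ht
    rw [time_zero, sub_zero, pow_zero, one_smul]
    exact Traj.eq_flow_half hx h0 h1 t ht
  | succ n ih =>
    set v := x 0 1 + D.k with hv
    have hvpos : 0 < v := by linarith [D.k_pos]
    have hτ := τ_mem (D := D) hvpos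
    have hnext : -x (D.τ v) = ![0, D.next v - D.k] := by
      rw [Traj.eq_flow_half hx h0 h1 (D.τ v) ⟨hτ.1.le, le_rfl⟩, flow_τ hvpos, neg_neg, flow_start]
    -- By odd symmetry, the negated tail is again a trajectory starting on the line, now with p = R
    -- + k > k, so the induction hypothesis applies to it.
    have hy := (IsTrajectory.shift hx hτ.1.le).neg
    have hy0 : (-x (0 + D.τ v)) 0 = 0 := by
      simp only [zero_add, hnext, Matrix.cons_val_zero]
    have hy1 : (-x (0 + D.τ v)) 1 = D.next v - D.k := by
      simp only [zero_add, hnext, Matrix.cons_val_one, Matrix.cons_val_zero]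
    have hR := R_pos hτ
    have := ih hy hy0 (by rw [hy1, next]; linarith [D.k_pos])
    rw [hy1, sub_add_cancel] at this
    intro t ht
    rw [time_succ' v n, time_succ' v (n + 1)] at ht
    have h := this (t - D.τ v) ⟨by linarith [ht.1], by linarith [ht.2]⟩
    simp only [sub_add_cancel] at h
    rw [time_succ', Function.iterate_succ_apply, pow_succ, mul_neg_one, neg_smul,
      show t - (D.time (D.next v) n + D.τ v) = t - D.τ v - D.time (D.next v) n by ring, ← h, neg_neg]

theorem contDiff_flow (η w : ℝ) : ContDiff ℝ 1 (D.flow η w) := by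
  refine contDiff_pi.2 fun i => ?_
  have h0 : ContDiff ℝ 1 fun t => D.flow η w t 0 := by
    refine contDiff_one_iff_deriv.2 ⟨fun t => (hasDerivAt_flow_zero η w t).differentiableAt, ?_⟩
    rw [show deriv (fun t => D.flow η w t 0) = _ from
      funext fun t => (hasDerivAt_flow_zero η w t).deriv]
    exact (continuous_flow_apply η w 1).add_const _
  have h1 : ContDiff ℝ 1 fun t => D.flow η w t 1 := by
    refine contDiff_one_iff_deriv.2 ⟨fun t => (hasDerivAt_flow_one η w t).differentiableAt, ?_⟩
    rw [show deriv (fun t => D.flow η w t 1) = _ from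
      funext fun t => (hasDerivAt_flow_one η w t).deriv]
    exact (((continuous_flow_apply η w 0).add_const _).const_mul _).sub
      (((continuous_flow_apply η w 1).add_const _).const_mul _)
  fin_cases i
  · exact h0
  · exact h1

theorem exists_hasDerivAt_flow {η w t : ℝ} (ht : 0 < D.flow η w t 0) :
    ∃ v ∈ filippovField D.stateMatrix D.input D.output (D.flow η w t),
      HasDerivAt (D.flow η w) v t := by
  refine ⟨![D.flow η w t 1 + D.k, -D.b * (D.flow η w t 0 + D.g) - D.a * (D.flow η w t 1 + D.k)],
    D.mem_field_iff.2 ⟨1, ⟨fun _ => rfl, fun h => absurd h ht.le.not_gt, fun h => absurd h ht.ne'⟩,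
      ?_, ?_⟩, hasDerivAt_pi.2 fun i => ?_⟩
  · simp
  · simp only [Matrix.cons_val_one, Matrix.cons_val_zero]
    ring
  · fin_cases i
    · exact hasDerivAt_flow_zero η w t
    · exact hasDerivAt_flow_one η w t

/-- A piece of a function that is, up to sign, a translate of the flow. -/
theorem lipschitz_and_hasDerivAt_of_eq_flow {η w c d σ : ℝ} (hσ : σ = 1 ∨ σ = -1)
    (hx : ∀ t ∈ Icc c d, x t = σ • D.flow η w (t - c))
    (hpos : ∀ t ∈ Ioo 0 (d - c), 0 < D.flow η w t 0) :
    (∃ K, LipschitzOnWith K x (Icc c d)) ∧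
      ∀ t ∈ Ioo c d, ∃ v ∈ filippovField D.stateMatrix D.input D.output (x t), HasDerivAt x v t := by
  constructor
  · have hf : ContDiff ℝ 1 fun t => σ • D.flow η w (t - c) :=
      ((contDiff_flow η w).comp (contDiff_id.sub contDiff_const)).const_smul σ
    obtain ⟨K, hK⟩ := hf.contDiffOn.exists_lipschitzOnWith one_ne_zero (convex_Icc c d) isCompact_Icc
    refine ⟨K, fun s hs t ht => ?_⟩
    rw [hx s hs, hx t ht]
    exact hK hs ht
  · intro t ht
    obtain ⟨v, hv, hd⟩ := exists_hasDerivAt_flow (hpos (t - c)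
      ⟨by linarith [ht.1], by linarith [ht.2]⟩)
    have hev : x =ᶠ[𝓝 t] fun t => σ • D.flow η w (t - c) := by
      filter_upwards [Icc_mem_nhds ht.1 ht.2] with s hs using hx s hs
    refine ⟨σ • v, ?_, ((hd.comp_sub_const t c).const_smul σ).congr_of_eventuallyEq hev⟩
    rw [hx t ⟨ht.1.le, ht.2.le⟩]
    rcases hσ with rfl | rfl
    · simpa using hv
    · simpa using neg_mem_filippovField hv

theorem Follows.pieces {v : ℝ} (hv : 0 < v) (hx : D.Follows v x) (n : ℕ) :
    (∃ K, LipschitzOnWith K x (Icc (D.time v n) (D.time v (n + 1)))) ∧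
      ∀ t ∈ Ioo (D.time v n) (D.time v (n + 1)),
        ∃ w ∈ filippovField D.stateMatrix D.input D.output (x t), HasDerivAt x w t := by
  refine lipschitz_and_hasDerivAt_of_eq_flow (neg_one_pow_eq_or ℝ n) (hx n) fun t ht => ?_
  rw [time_succ, add_sub_cancel_left] at ht
  exact flow_output_pos (iterate_pos hv n) ht

theorem Follows.traj {v : ℝ} (hv : 0 < v) (hx : D.Follows v x) : D.Traj x :=
  isTrajectory_of_pieces (time_zero v) (tendsto_time hv)
    (fun n => (hx.pieces hv n).1) (fun n => (hx.pieces hv n).2)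

theorem Follows.exists_ne_zero {v : ℝ} (hv : 0 < v) (hx : D.Follows v x) :
    ∃ t, 0 ≤ t ∧ x t ≠ 0 := by
  have hτ := τ_mem (D := D) hv
  refine ⟨D.τ v, hτ.1.le, fun h => ?_⟩
  have e := hx 0 (D.τ v) (by
    rw [time_succ, time_zero, zero_add]
    exact ⟨hτ.1.le, le_rfl⟩)
  rw [time_zero, sub_zero, pow_zero, one_smul, Function.iterate_zero_apply, flow_τ hv, flow_start,
    h] at e
  have e1 := congrFun e 1
  simp only [Pi.zero_apply, Pi.neg_apply, Matrix.cons_val_one, Matrix.cons_val_zero, next] at e1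
  linarith [R_pos hτ, D.k_pos]

/-- Serves initial states off the switching line: a first arc of the flow, then a negated
concatenation of half cycles. -/
theorem traj_of_flow_append {η w T v : ℝ} (hv : 0 < v)
    (hpos : ∀ t ∈ Ico 0 T, 0 < D.flow η w t 0) {y : ℝ → Fin 2 → ℝ} (hy : D.Follows v y)
    (hmatch : D.flow η w T = -y 0) :
    D.Traj fun t => if t ≤ T then D.flow η w t else -y (t - T) := by
  have hsecond : ∀ t, T ≤ t → (if t ≤ T then D.flow η w t else -y (t - T)) = -y (t - T) :=
    fun t ht => by
      rcases ht.eq_or_lt with h | h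
      · rw [if_pos h.ge, ← h, sub_self, hmatch]
      · rw [if_neg h.not_ge]
  -- Index 0 is the first arc, which shifts the half cycles by one; this absorbs the minus sign into
  -- (-1)^(n+1).
  set s : ℕ → ℝ := fun n => Nat.casesOn n 0 fun m => T + D.time v m
  have hs0 : s 0 = 0 := rfl
  have hs : ∀ n, s (n + 1) = T + D.time v n := fun _ => rfl
  have hpieces : ∀ n, (∃ K, LipschitzOnWith K
      (fun t => if t ≤ T then D.flow η w t else -y (t - T)) (Icc (s n) (s (n + 1)))) ∧
      ∀ t ∈ Ioo (s n) (s (n + 1)), ∃ v ∈ filippovField D.stateMatrix D.input D.output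
        ((fun t => if t ≤ T then D.flow η w t else -y (t - T)) t),
        HasDerivAt (fun t => if t ≤ T then D.flow η w t else -y (t - T)) v t := by
    intro n
    cases n with
    | zero =>
      refine lipschitz_and_hasDerivAt_of_eq_flow (η := η) (w := w) (Or.inl rfl) (fun t ht => ?_)
        fun t ht => hpos t ?_
      · simp only [hs, time_zero, add_zero] at ht
        simp only [hs0, sub_zero, one_smul]
        rw [if_pos ht.2]
      · simp only [hs0, hs, time_zero, add_zero, sub_zero] at ht
        exact ⟨ht.1.le, ht.2⟩
    | succ n =>
      refine lipschitz_and_hasDerivAt_of_eq_flow (η := D.g) (w := D.next^[n] v)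
        (neg_one_pow_eq_or ℝ (n + 1)) (fun t ht => ?_) fun t ht => ?_
      · simp only [hs] at ht ⊢
        have h0 : 0 ≤ D.time v n := by
          rw [← time_zero (D := D) v]
          exact (time_strictMono hv).monotone (Nat.zero_le n)
        rw [hsecond t (by linarith [ht.1]), hy n (t - T) ⟨by linarith [ht.1], by linarith [ht.2]⟩,
          pow_succ, mul_neg_one, neg_smul, sub_sub]
      · simp only [hs, time_succ] at ht
        exact flow_output_pos (iterate_pos hv n) ⟨ht.1, by linarith [ht.2]⟩
  refine isTrajectory_of_pieces (s := s) rfl ?_ (fun n => (hpieces n).1) (fun n => (hpieces n).2)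
  rw [← tendsto_add_atTop_iff_nat 1]
  exact tendsto_atTop_add_const_left _ _ (tendsto_time hv)

/-- From every state there starts a trajectory other than the equilibrium. -/
theorem exists_traj (D : Relay) (ξ : Fin 2 → ℝ) :
    ∃ x, D.Traj x ∧ x 0 = ξ ∧ ∃ t, 0 ≤ t ∧ x t ≠ 0 := by
  -- On the line, p ≥ 0 already gives a positive departure speed p + k, so even states in the
  -- repelling segment, the origin among them, may leave at once. The remaining states follow by odd
  -- symmetry.
  have key : ∀ ξ : Fin 2 → ℝ, 0 < ξ 0 ∨ ξ 0 = 0 ∧ 0 ≤ ξ 1 →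
      ∃ x, D.Traj x ∧ x 0 = ξ ∧ ∃ t, 0 ≤ t ∧ x t ≠ 0 := by
    rintro ξ (h | ⟨h0, h1⟩)
    · obtain ⟨T, hT, hT0, hT1, hpos⟩ := D.exists_flow_hit (η := ξ 0 + D.g) (w := ξ 1 + D.k)
        (by linarith)
      have hv : 0 < -D.flow (ξ 0 + D.g) (ξ 1 + D.k) T 1 + D.k := by linarith [D.k_pos]
      obtain ⟨y, hy⟩ := D.exists_follows hv
      have hmatch : D.flow (ξ 0 + D.g) (ξ 1 + D.k) T = -y 0 := by
        rw [hy.initial hv]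
        ext i
        fin_cases i
        · simpa using hT0
        · simp
      have hinit : (if (0 : ℝ) ≤ T then D.flow (ξ 0 + D.g) (ξ 1 + D.k) 0 else -y (0 - T)) = ξ := by
        rw [if_pos hT.le, flow_zero, add_sub_cancel_right, add_sub_cancel_right]
        ext i
        fin_cases i <;> rfl
      refine ⟨_, traj_of_flow_append hv hpos hy hmatch, hinit, 0, le_rfl, ?_⟩
      intro h'
      have h2 : ξ = 0 := hinit.symm.trans h'
      rw [h2] at h
      exact lt_irrefl _ h
    · have hv : 0 < ξ 1 + D.k := by linarith [D.k_pos]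
      obtain ⟨y, hy⟩ := D.exists_follows hv
      refine ⟨y, hy.traj hv, ?_, hy.exists_ne_zero hv⟩
      rw [hy.initial hv, add_sub_cancel_right]
      ext i
      fin_cases i
      · exact h0.symm
      · rfl
  by_cases hξ : 0 < ξ 0 ∨ ξ 0 = 0 ∧ 0 ≤ ξ 1
  · exact key ξ hξ
  · obtain ⟨x, hx, hx0, t, ht, hne⟩ := key (-ξ) (by
      simp only [Pi.neg_apply]
      push Not at hξ
      rcases hξ.1.lt_or_eq with h | h
      · exact Or.inl (by linarith)
      · exact Or.inr ⟨by linarith, by linarith [hξ.2 h]⟩)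
    exact ⟨_, hx.neg, by simp [hx0], t, ht, by simpa using hne⟩

end Relay

theorem ConvergesTo.of_shift {x : ℝ → Fin 2 → ℝ} {Γ : Set (Fin 2 → ℝ)} {c : ℝ}
    (h : ConvergesTo (fun t => x (t + c)) Γ) : ConvergesTo x Γ := by
  have := h.comp (tendsto_atTop_add_const_right atTop (-c) tendsto_id)
  refine this.congr fun t => ?_
  simp

theorem ConvergesTo.of_neg {x : ℝ → Fin 2 → ℝ} {Γ : Set (Fin 2 → ℝ)}
    (hΓ : ∀ ξ, ξ ∈ Γ ↔ -ξ ∈ Γ) (h : ConvergesTo (fun t => -x t) Γ) : ConvergesTo x Γ := by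
  have himg : (fun ξ : Fin 2 → ℝ => -ξ) '' Γ = Γ := by
    ext ξ
    constructor
    · rintro ⟨ζ, hζ, rfl⟩
      exact (hΓ ζ).1 hζ
    · exact fun hξ => ⟨-ξ, (hΓ ξ).1 hξ, neg_neg ξ⟩
  refine h.congr fun t => ?_
  have := Metric.infDist_image (Φ := fun ξ : Fin 2 → ℝ => -ξ) (x := x t) (t := Γ)
    (IsometryEquiv.neg (Fin 2 → ℝ)).isometry
  rwa [himg] at this

/-! ### The limit cycle: period, symmetry, switchings -/

namespace Relay

variable {D : Relay} {x : ℝ → Fin 2 → ℝ}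

/-- The half period of the limit cycle. -/
noncomputable def half (D : Relay) : ℝ := D.τ D.vStar

theorem half_pos (D : Relay) : 0 < D.half := (τ_mem D.vStar_pos).1

/-- The flow along the positive half of the limit cycle. -/
noncomputable def arc (D : Relay) : ℝ → Fin 2 → ℝ := D.flow D.g D.vStar

theorem iterate_vStar (D : Relay) (n : ℕ) : D.next^[n] D.vStar = D.vStar :=
  Function.iterate_fixed D.next_vStar n

theorem time_vStar (D : Relay) (n : ℕ) : D.time D.vStar n = n * D.half := by
  simp [time, iterate_vStar, half]

theorem k_lt_vStar (D : Relay) : D.k < D.vStar := by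
  have h := D.next_vStar
  rw [next] at h
  linarith [R_pos (τ_mem (D := D) D.vStar_pos), D.k_pos]

theorem arc_zero (D : Relay) : D.arc 0 = ![0, D.vStar - D.k] := flow_start _

theorem arc_half (D : Relay) : D.arc D.half = -D.arc 0 := by
  have := flow_τ (D := D) D.vStar_pos
  rwa [next_vStar] at this

theorem arc_pos {t : ℝ} (ht : t ∈ Ioo 0 D.half) : 0 < D.arc t 0 := flow_output_pos D.vStar_pos ht

/-- The periodic trajectory. -/
noncomputable def cycle (D : Relay) : ℝ → Fin 2 → ℝ := (D.exists_follows D.vStar_pos).choose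

theorem follows_cycle (D : Relay) : D.Follows D.vStar D.cycle :=
  (D.exists_follows D.vStar_pos).choose_spec

theorem traj_cycle (D : Relay) : D.Traj D.cycle := D.follows_cycle.traj D.vStar_pos

theorem cycle_eq (D : Relay) (n : ℕ) {t : ℝ} (ht : t ∈ Icc (n * D.half) ((n + 1) * D.half)) :
    D.cycle t = (-1 : ℝ) ^ n • D.arc (t - n * D.half) := by
  have := D.follows_cycle n t (by
    rw [time_vStar, time_vStar]
    push_cast
    exact ht)
  rwa [iterate_vStar, time_vStar] at this

theorem exists_index (D : Relay) {t : ℝ} (ht : 0 ≤ t) :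
    ∃ n : ℕ, t ∈ Ico (n * D.half) ((n + 1) * D.half) := by
  obtain ⟨n, hn⟩ := exists_time_index (D := D) D.vStar_pos ht
  rw [time_vStar, time_vStar] at hn
  push_cast at hn
  exact ⟨n, hn⟩

theorem cycle_add_half (D : Relay) {t : ℝ} (ht : 0 ≤ t) : D.cycle (t + D.half) = -D.cycle t := by
  obtain ⟨n, hn⟩ := D.exists_index ht
  rw [D.cycle_eq n ⟨hn.1, hn.2.le⟩, D.cycle_eq (n + 1) (by
    push_cast
    exact ⟨by linarith [hn.1], by linarith [hn.2]⟩), pow_succ, mul_neg_one, neg_smul]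
  congr 3
  push_cast
  ring

theorem cycle_eq_arc {t : ℝ} (ht : t ∈ Icc 0 D.half) : D.cycle t = D.arc t := by
  have := D.cycle_eq 0 (t := t) (by simpa using ht)
  simpa using this

theorem cycle_eq_neg_arc {t : ℝ} (ht : t ∈ Icc D.half (2 * D.half)) :
    D.cycle t = -D.arc (t - D.half) := by
  have := D.cycle_add_half (t := t - D.half) (by linarith [ht.1])
  rwa [sub_add_cancel, cycle_eq_arc (t := t - D.half)
    ⟨by linarith [ht.1], by linarith [ht.2]⟩] at this

theorem cycle_output_pos {t : ℝ} (ht : t ∈ Ioo 0 D.half) : 0 < D.cycle t 0 := by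
  rw [cycle_eq_arc ⟨ht.1.le, ht.2.le⟩]
  exact arc_pos ht

theorem cycle_output_neg {t : ℝ} (ht : t ∈ Ioo D.half (2 * D.half)) : D.cycle t 0 < 0 := by
  rw [cycle_eq_neg_arc ⟨ht.1.le, ht.2.le⟩, Pi.neg_apply, neg_lt_zero]
  exact arc_pos ⟨by linarith [ht.1], by linarith [ht.2]⟩

theorem cycle_add_period (D : Relay) {t : ℝ} (ht : 0 ≤ t) :
    D.cycle (t + 2 * D.half) = D.cycle t := by
  rw [two_mul, ← add_assoc, D.cycle_add_half (by linarith [D.half_pos]), D.cycle_add_half ht, neg_neg]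

theorem cycle_zero (D : Relay) : D.cycle 0 = ![0, D.vStar - D.k] :=
  D.follows_cycle.initial D.vStar_pos

theorem cycle_half (D : Relay) : D.cycle D.half = -D.cycle 0 := by
  simpa using D.cycle_add_half le_rfl

theorem isPeriodicTrajectory_cycle (D : Relay) :
    IsPeriodicTrajectory D.stateMatrix D.input D.output D.cycle (2 * D.half) := by
  have hh := D.half_pos
  refine ⟨D.traj_cycle, ⟨by linarith, fun t ht => D.cycle_add_period ht⟩, ?_⟩
  rintro S ⟨hS, hper⟩
  by_contra hcon
  have hS2 : S < 2 * D.half := not_le.1 hcon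
  have h0 := hper 0 le_rfl
  rw [zero_add] at h0
  -- A shorter period would have to be a zero of the output, hence the half period; but there the
  -- state is the negative of the nonzero initial one.
  have hz : D.cycle S 0 = 0 := by rw [h0, cycle_zero]; rfl
  rcases lt_trichotomy S D.half with h | h | h
  · exact (cycle_output_pos ⟨hS, h⟩).ne' hz
  · rw [h, cycle_half, cycle_zero] at h0
    have := congrFun h0 1
    simp only [Pi.neg_apply, Matrix.cons_val_one, Matrix.cons_val_zero] at this
    linarith [D.k_lt_vStar]
  · exact (cycle_output_neg ⟨h, hS2⟩).ne hz

theorem isSymmetric_cycle (D : Relay) : IsSymmetric D.cycle := by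
  have key : ∀ ξ, ξ ∈ locus D.cycle → -ξ ∈ locus D.cycle := by
    rintro _ ⟨t, ht, rfl⟩
    exact ⟨t + D.half, add_nonneg ht D.half_pos.le, D.cycle_add_half ht⟩
  exact fun ξ => ⟨key ξ, fun h => by simpa using key _ h⟩

theorem arc_mem_locus {t : ℝ} (ht : t ∈ Icc 0 D.half) : D.arc t ∈ locus D.cycle :=
  ⟨t, ht.1, cycle_eq_arc ht⟩

theorem exists_arc_of_mem_locus {ξ : Fin 2 → ℝ} (hξ : ξ ∈ locus D.cycle) :
    ∃ t ∈ Icc 0 D.half, ξ = D.arc t ∨ ξ = -D.arc t := by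
  obtain ⟨t, ht, rfl⟩ := hξ
  obtain ⟨n, hn⟩ := D.exists_index ht
  refine ⟨t - n * D.half, ⟨by linarith [hn.1], by linarith [hn.2]⟩, ?_⟩
  rw [D.cycle_eq n ⟨hn.1, hn.2.le⟩]
  rcases neg_one_pow_eq_or ℝ n with h | h
  · left
    rw [h, one_smul]
  · right
    rw [h, neg_one_smul]

theorem continuous_arc (D : Relay) : Continuous D.arc := (contDiff_flow _ _).continuous

theorem isClosed_locus_cycle (D : Relay) : IsClosed (locus D.cycle) := by
  have h : locus D.cycle = D.arc '' Icc 0 D.half ∪ (fun t => -D.arc t) '' Icc 0 D.half := by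
    ext ξ
    constructor
    · intro hξ
      obtain ⟨t, ht, rfl | rfl⟩ := exists_arc_of_mem_locus hξ
      · exact Or.inl ⟨t, ht, rfl⟩
      · exact Or.inr ⟨t, ht, rfl⟩
    · rintro (⟨t, ht, rfl⟩ | ⟨t, ht, rfl⟩)
      · exact arc_mem_locus ht
      · exact (D.isSymmetric_cycle _).1 (arc_mem_locus ht)
  rw [h]
  exact ((isCompact_Icc.image D.continuous_arc).union
    (isCompact_Icc.image D.continuous_arc.neg)).isClosed

/-- The limit cycle meets the switching line in two opposite points only. -/
theorem eq_of_mem_locus {ξ : Fin 2 → ℝ} (hξ : ξ ∈ locus D.cycle) (h0 : ξ 0 = 0) :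
    ξ = ![0, D.vStar - D.k] ∨ ξ = -![0, D.vStar - D.k] := by
  obtain ⟨t, ht, h⟩ := exists_arc_of_mem_locus hξ
  have hz : D.arc t 0 = 0 := by
    rcases h with rfl | rfl
    · exact h0
    · simpa using h0
  rcases ht.1.eq_or_lt with e | e
  · rw [← e, arc_zero] at h
    exact h
  rcases ht.2.eq_or_lt with e' | e'
  · rw [e', arc_half, arc_zero, neg_neg] at h
    exact h.symm
  · exact absurd hz (arc_pos ⟨e, e'⟩).ne'

theorem switchesAt_half (D : Relay) : SwitchesAt D.output D.cycle D.half := by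
  have hh := D.half_pos
  refine Or.inl ⟨?_, ?_⟩
  · filter_upwards [Ioo_mem_nhdsLT hh] with s hs
    rw [output_dotProduct]
    exact cycle_output_pos hs
  · filter_upwards [Ioo_mem_nhdsGT (show D.half < 2 * D.half by linarith)] with s hs
    rw [output_dotProduct]
    exact cycle_output_neg hs

theorem switchesAt_period (D : Relay) : SwitchesAt D.output D.cycle (2 * D.half) := by
  have hh := D.half_pos
  refine Or.inr ⟨?_, ?_⟩
  · filter_upwards [Ioo_mem_nhdsLT (show D.half < 2 * D.half by linarith)] with s hs
    rw [output_dotProduct]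
    exact cycle_output_neg hs
  · filter_upwards [Ioo_mem_nhdsGT (show 2 * D.half < 3 * D.half by linarith)] with s hs
    rw [output_dotProduct]
    have := D.cycle_add_period (t := s - 2 * D.half) (by linarith [hs.1])
    rw [sub_add_cancel] at this
    rw [this]
    exact cycle_output_pos ⟨by linarith [hs.1], by linarith [hs.2]⟩

theorem not_switchesAt {C : Fin 2 → ℝ} {t : ℝ}
    (h : (∀ᶠ s in 𝓝 t, 0 < C ⬝ᵥ x s) ∨ ∀ᶠ s in 𝓝 t, C ⬝ᵥ x s < 0) : ¬ SwitchesAt C x t := by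
  rcases h with h | h <;> rintro (⟨h1, h2⟩ | ⟨h1, h2⟩)
  · obtain ⟨s, hs, hs'⟩ := ((h.filter_mono nhdsWithin_le_nhds).and h2).exists
    linarith
  · obtain ⟨s, hs, hs'⟩ := ((h.filter_mono nhdsWithin_le_nhds).and h1).exists
    linarith
  · obtain ⟨s, hs, hs'⟩ := ((h.filter_mono nhdsWithin_le_nhds).and h1).exists
    linarith
  · obtain ⟨s, hs, hs'⟩ := ((h.filter_mono nhdsWithin_le_nhds).and h2).exists
    linarith

theorem isUnimodal_cycle (D : Relay) : IsUnimodal D.output D.cycle (2 * D.half) := by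
  have hh := D.half_pos
  refine ⟨?_, fun t ht h0 => ?_⟩
  · rw [show {t : ℝ | t ∈ Ioc 0 (2 * D.half) ∧ SwitchesAt D.output D.cycle t}
      = {D.half, 2 * D.half} from ?_, ncard_pair (by linarith)]
    ext t
    simp only [mem_ofPred_eq, mem_insert_iff, mem_singleton_iff]
    constructor
    · rintro ⟨ht, hsw⟩
      rcases lt_trichotomy t D.half with h | h | h
      · refine absurd hsw (not_switchesAt (Or.inl ?_))
        filter_upwards [Ioo_mem_nhds ht.1 h] with s hs
        rw [output_dotProduct]
        exact cycle_output_pos hs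
      · exact Or.inl h
      rcases ht.2.eq_or_lt with h' | h'
      · exact Or.inr h'
      · refine absurd hsw (not_switchesAt (Or.inr ?_))
        filter_upwards [Ioo_mem_nhds h h'] with s hs
        rw [output_dotProduct]
        exact cycle_output_neg hs
    · rintro (rfl | rfl)
      · exact ⟨⟨hh, by linarith⟩, D.switchesAt_half⟩
      · exact ⟨⟨by linarith, le_rfl⟩, D.switchesAt_period⟩
  · rw [output_dotProduct] at h0
    rcases lt_trichotomy t D.half with h | h | h
    · exact absurd h0 (cycle_output_pos ⟨ht.1, h⟩).ne'
    · rw [h]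
      exact D.switchesAt_half
    rcases ht.2.eq_or_lt with h' | h'
    · rw [h']
      exact D.switchesAt_period
    · exact absurd h0 (cycle_output_neg ⟨h, h'⟩).ne

/-! ### Global convergence and uniqueness of the periodic orbit -/

theorem dist_flow_le {v w t M : ℝ} (hβ : |D.β t| ≤ M) (hγ : |D.γ t| ≤ M) :
    dist (D.flow D.g v t) (D.flow D.g w t) ≤ M * |v - w| := by
  have hM : 0 ≤ M := (abs_nonneg _).trans hβ
  refine (dist_pi_le_iff (mul_nonneg hM (abs_nonneg _))).2 fun i => ?_
  rw [Real.dist_eq]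
  fin_cases i
  · simp only [Fin.zero_eta, flow_apply_zero]
    rw [show D.α t * D.g + D.β t * v - D.g - (D.α t * D.g + D.β t * w - D.g) = D.β t * (v - w) by
      ring, abs_mul]
    gcongr
  · simp only [Fin.mk_one, flow_apply_one]
    rw [show -D.b * D.β t * D.g + D.γ t * v - D.k - (-D.b * D.β t * D.g + D.γ t * w - D.k)
      = D.γ t * (v - w) by ring, abs_mul]
    gcongr

/-- The solution with switchings beyond the sliding segment converges to the limit cycle. -/
theorem Follows.convergesTo {v : ℝ} (hv : 0 < v) (hx : D.Follows v x) :
    ConvergesTo x (locus D.cycle) := by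
  obtain ⟨Mβ, hMβ⟩ := (isCompact_Icc (a := (0 : ℝ)) (b := D.half + 1)).exists_bound_of_continuousOn
    D.continuous_β.continuousOn
  obtain ⟨Mγ, hMγ⟩ := (isCompact_Icc (a := (0 : ℝ)) (b := D.half + 1)).exists_bound_of_continuousOn
    D.continuous_γ.continuousOn
  set M := max (max Mβ Mγ) 0 + 1 with hM
  have hMpos : 0 < M := by
    have := le_max_right (max Mβ Mγ) 0
    linarith
  have hβM : ∀ t ∈ Icc 0 (D.half + 1), |D.β t| ≤ M := fun t ht => by
    have := hMβ t ht
    rw [Real.norm_eq_abs] at this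
    linarith [le_max_left Mβ Mγ, le_max_left (max Mβ Mγ) 0]
  have hγM : ∀ t ∈ Icc 0 (D.half + 1), |D.γ t| ≤ M := fun t ht => by
    have := hMγ t ht
    rw [Real.norm_eq_abs] at this
    linarith [le_max_right Mβ Mγ, le_max_left (max Mβ Mγ) 0]
  refine Metric.tendsto_atTop.2 fun ε hε => ?_
  obtain ⟨δ, hδ, hcont⟩ := Metric.continuousAt_iff.1
    (D.continuous_arc.continuousAt (x := D.half)) (ε / 2) (by linarith)
  have h1 := (tendsto_τ_iterate (D := D) hv).eventually
    (gt_mem_nhds (show D.half < D.half + min δ 1 by linarith [lt_min hδ one_pos]))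
  have h2 := (tendsto_iterate (D := D) hv).eventually (Metric.ball_mem_nhds _
    (show 0 < ε / 2 / M by positivity))
  obtain ⟨N, hN⟩ := eventually_atTop.1 (h1.and h2)
  refine ⟨D.time v N, fun t ht => ?_⟩
  have hmono := time_strictMono (D := D) hv
  have ht0 : 0 ≤ t := by
    have := hmono.monotone (Nat.zero_le N)
    rw [time_zero] at this
    exact this.trans ht
  obtain ⟨n, hn⟩ := exists_time_index (D := D) hv ht0
  have hNn : N ≤ n := Nat.lt_succ_iff.1 (hmono.lt_iff_lt.1 (lt_of_le_of_lt ht hn.2))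
  obtain ⟨hτ, hvn⟩ := hN n hNn
  rw [Real.dist_eq] at hvn
  set s := t - D.time v n with hs
  have hs0 : 0 ≤ s := by linarith [hn.1]
  have hsτ : s < D.half + min δ 1 := by
    have := hn.2
    rw [time_succ] at this
    linarith
  have hsI : s ∈ Icc 0 (D.half + 1) := ⟨hs0, by linarith [min_le_right δ 1]⟩
  have hd1 : dist (D.flow D.g (D.next^[n] v) s) (D.arc s) < ε / 2 := by
    refine (dist_flow_le (hβM s hsI) (hγM s hsI)).trans_lt ?_
    rwa [lt_div_iff₀ hMpos, mul_comm] at hvn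
  -- A half cycle may outlast the limiting one by less than δ, so the time on the arc is cut off at
  -- `half`.
  have hd2 : dist (D.arc s) (D.arc (min s D.half)) < ε / 2 := by
    rcases le_total s D.half with h | h
    · rw [min_eq_left h, dist_self]
      linarith
    · rw [min_eq_right h]
      refine hcont ?_
      rw [Real.dist_eq, abs_of_nonneg (by linarith)]
      linarith [min_le_left δ 1]
  have hmem : (-1 : ℝ) ^ n • D.arc (min s D.half) ∈ locus D.cycle := by
    have := arc_mem_locus (D := D) (t := min s D.half) ⟨le_min hs0 D.half_pos.le, min_le_right _ _⟩
    rcases neg_one_pow_eq_or ℝ n with h | h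
    · rwa [h, one_smul]
    · rw [h, neg_one_smul]
      exact (D.isSymmetric_cycle _).1 this
  rw [Real.dist_eq, sub_zero, abs_of_nonneg Metric.infDist_nonneg]
  refine (Metric.infDist_le_dist_of_mem hmem).trans_lt ?_
  rw [hx n t ⟨hn.1, hn.2.le⟩, dist_smul₀]
  simp only [norm_pow, norm_neg, norm_one, one_pow, one_mul]
  exact (dist_triangle _ (D.arc s) _).trans_lt (by linarith)

/-- Every trajectory other than the equilibrium eventually leaves the switching line beyond the
sliding segment. -/
theorem Traj.exists_follows_tail (hx : D.Traj x) (hne : ∃ t, 0 ≤ t ∧ x t ≠ 0) :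
    ∃ T, 0 ≤ T ∧ x T 0 = 0 ∧ D.k < |x T 1| ∧
      (D.Follows (|x T 1| + D.k) (fun t => x (t + T)) ∨
        D.Follows (|x T 1| + D.k) (fun t => -x (t + T))) := by
  obtain ⟨T, hT, h0, h1⟩ := Traj.exists_crossing hx hne
  refine ⟨T, hT, h0, h1, ?_⟩
  rcases le_total 0 (x T 1) with h | h
  · left
    rw [abs_of_nonneg h] at h1 ⊢
    have := Traj.follows (IsTrajectory.shift hx hT) (by simpa using h0) (by simpa using h1)
    simpa using this
  · right
    rw [abs_of_nonpos h] at h1 ⊢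
    have := Traj.follows (IsTrajectory.shift hx hT).neg (by simpa using h0) (by simpa using h1)
    simpa using this

theorem Traj.convergesTo (hx : D.Traj x) (hne : ∃ t, 0 ≤ t ∧ x t ≠ 0) :
    ConvergesTo x (locus D.cycle) := by
  obtain ⟨T, -, -, h1, h | h⟩ := Traj.exists_follows_tail hx hne
  · exact (h.convergesTo (by linarith [D.k_pos])).of_shift
  · exact ((h.convergesTo (by linarith [D.k_pos])).of_neg
      (x := fun t => x (t + T)) D.isSymmetric_cycle).of_shift

/-- All periodic trajectories have the same locus. -/
theorem locus_eq_of_periodic {S : ℝ}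
    (hx : IsPeriodicTrajectory D.stateMatrix D.input D.output x S) : locus x = locus D.cycle := by
  obtain ⟨htraj, ⟨hS, hper⟩, hleast⟩ := hx
  have hne : ∃ t, 0 ≤ t ∧ x t ≠ 0 := by
    by_contra! hcon
    -- The zero solution would also have period S / 2.
    have := hleast (a := S / 2) ⟨by linarith, fun t ht => by
      rw [hcon t ht, hcon _ (by linarith)]⟩
    linarith
  have hsub : locus x ⊆ locus D.cycle := by
    rintro _ ⟨t, ht, rfl⟩
    have ht : 0 ≤ t := ht
    -- Along t + n S the distance to the cycle is constant and tends to 0, so it is 0; the cycle is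
    -- closed.
    have hconst : ∀ n : ℕ, x (t + n * S) = x t := fun n => by
      induction n with
      | zero => simp
      | succ n ih =>
        have := hper (t + n * S) (by positivity)
        rw [← ih, ← this]
        push_cast
        ring_nf
    have hlim : Tendsto (fun n : ℕ => t + n * S) atTop atTop :=
      tendsto_atTop_add_const_left _ _ (tendsto_natCast_atTop_atTop.atTop_mul_const hS)
    have h0 := (Traj.convergesTo htraj hne).comp hlim
    simp only [Function.comp_def, hconst] at h0
    have h0 := tendsto_nhds_unique tendsto_const_nhds h0
    exact (D.isClosed_locus_cycle.mem_iff_infDist_zero ⟨_, 0, self_mem_Ici, rfl⟩).2 h0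
  refine hsub.antisymm ?_
  obtain ⟨T, hT, h0, h1, hf⟩ := Traj.exists_follows_tail htraj hne
  -- The crossing point lies on the cycle, which meets the line in two opposite points only; this
  -- fixes the departure speed.
  have hv : |x T 1| + D.k = D.vStar := by
    have hpos : 0 < D.vStar - D.k := by linarith [D.k_lt_vStar]
    rcases eq_of_mem_locus (hsub ⟨T, hT, rfl⟩) h0 with h | h
    · rw [h]
      simp [abs_of_pos hpos]
    · rw [h]
      simp only [Pi.neg_apply, Matrix.cons_val_one, Matrix.cons_val_zero, abs_neg, abs_of_pos hpos,
        sub_add_cancel]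
  rw [hv] at hf
  rintro ξ hξ
  rcases hf with hf | hf
  · obtain ⟨t, ht, rfl⟩ := hξ
    exact ⟨t + T, add_nonneg ht hT, hf.eq D.vStar_pos D.follows_cycle ht⟩
  · obtain ⟨t, ht, h⟩ := (D.isSymmetric_cycle ξ).1 hξ
    refine ⟨t + T, add_nonneg ht hT, ?_⟩
    have := hf.eq D.vStar_pos D.follows_cycle ht
    simp only [h] at this
    exact neg_injective this

end Relay

/-! ### Linear change of coordinates -/

open Polynomial

/-- A linear change of coordinates between two relay feedback systems. -/
structure IsConj (A : Matrix (Fin 2) (Fin 2) ℝ) (B C : Fin 2 → ℝ)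
    (A' : Matrix (Fin 2) (Fin 2) ℝ) (B' C' : Fin 2 → ℝ)
    (e : (Fin 2 → ℝ) ≃L[ℝ] (Fin 2 → ℝ)) : Prop where
  map_mulVec : ∀ ξ, e (A.mulVec ξ) = A'.mulVec (e ξ)
  map_input : e B = B'
  output_map : ∀ ξ, C' ⬝ᵥ e ξ = C ⬝ᵥ ξ

namespace IsConj

variable {A A' : Matrix (Fin 2) (Fin 2) ℝ} {B C B' C' : Fin 2 → ℝ}
  {e : (Fin 2 → ℝ) ≃L[ℝ] (Fin 2 → ℝ)} {x : ℝ → Fin 2 → ℝ}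

theorem symm (h : IsConj A B C A' B' C' e) : IsConj A' B' C' A B C e.symm where
  map_mulVec ξ := by
    rw [e.symm_apply_eq, h.map_mulVec, e.apply_symm_apply]
  map_input := by rw [e.symm_apply_eq, h.map_input]
  output_map ξ := by rw [← h.output_map, e.apply_symm_apply]

theorem isTrajectory (h : IsConj A B C A' B' C' e) (hx : IsTrajectory A B C x) :
    IsTrajectory A' B' C' fun t => e (x t) := by
  refine ⟨fun T hT => absolutelyContinuousOnInterval_comp e.lipschitz (hx.1 T hT), ?_⟩
  filter_upwards [hx.2] with t ht h0
  obtain ⟨v, ⟨u, hu, rfl⟩, hd⟩ := ht h0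
  refine ⟨_, ⟨u, ?_, ?_⟩, e.hasFDerivAt.comp_hasDerivAt t hd⟩
  · rwa [h.output_map]
  · rw [← h.map_mulVec, ← h.map_input, ← map_smul, ← map_sub]
    rfl

theorem isPeriodicTrajectory (h : IsConj A B C A' B' C' e) {T : ℝ}
    (hx : IsPeriodicTrajectory A B C x T) :
    IsPeriodicTrajectory A' B' C' (fun t => e (x t)) T :=
  ⟨h.isTrajectory hx.1, by simpa [e.injective.eq_iff] using hx.2⟩

end IsConj

theorem locus_map (e : (Fin 2 → ℝ) ≃L[ℝ] (Fin 2 → ℝ)) (x : ℝ → Fin 2 → ℝ) :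
    locus (fun t => e (x t)) = e '' locus x := by
  rw [locus, locus, image_image]

theorem ConvergesTo.map (e : (Fin 2 → ℝ) ≃L[ℝ] (Fin 2 → ℝ)) {x : ℝ → Fin 2 → ℝ}
    {Γ : Set (Fin 2 → ℝ)} (hΓ : Γ.Nonempty) (h : ConvergesTo x Γ) :
    ConvergesTo (fun t => e (x t)) (e '' Γ) := by
  obtain ⟨K, hK⟩ : ∃ K, LipschitzWith K e := ⟨_, e.lipschitz⟩
  refine squeeze_zero (fun _ => Metric.infDist_nonneg) (fun t => ?_)
    (by simpa using Tendsto.const_mul (K : ℝ) h)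
  -- The infimum need not be attained; dividing by K + 1 also covers K = 0.
  refine le_of_forall_pos_le_add fun ε hε => ?_
  have hε' : 0 < ε / (K + 1) := by positivity
  obtain ⟨y, hy, hd⟩ := (Metric.infDist_lt_iff (x := x t) hΓ).1 (lt_add_of_pos_right _ hε')
  calc Metric.infDist (e (x t)) (e '' Γ) ≤ dist (e (x t)) (e y) :=
        Metric.infDist_le_dist_of_mem (mem_image_of_mem e hy)
    _ ≤ K * dist (x t) y := hK.dist_le_mul _ _
    _ ≤ K * (Metric.infDist (x t) Γ + ε / (K + 1)) := by gcongr
    _ = K * Metric.infDist (x t) Γ + K / (K + 1) * ε := by ring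
    _ ≤ K * Metric.infDist (x t) Γ + 1 * ε := by
        gcongr
        rw [div_le_one (by positivity)]
        linarith
    _ = _ := by rw [one_mul]

/-- The global behaviour of a relay system that is conjugate to one in companion form. -/
theorem Relay.exists_limitCycle (D : Relay) {A : Matrix (Fin 2) (Fin 2) ℝ} {B C : Fin 2 → ℝ}
    {e : (Fin 2 → ℝ) ≃L[ℝ] (Fin 2 → ℝ)}
    (h : IsConj A B C D.stateMatrix D.input D.output e) :
    ∃ (c : ℝ → Fin 2 → ℝ) (T : ℝ), IsLimitCycle A B C c T ∧ IsSymmetric c ∧ IsUnimodal C c T ∧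
      (∀ x : ℝ → Fin 2 → ℝ, IsTrajectory A B C x → (∃ t : ℝ, 0 ≤ t ∧ x t ≠ 0) →
        ConvergesTo x (locus c)) ∧
      (∀ ξ : Fin 2 → ℝ, ∃ x : ℝ → Fin 2 → ℝ, IsTrajectory A B C x ∧ x 0 = ξ ∧
        ConvergesTo x (locus c)) := by
  have hloc := locus_map e.symm D.cycle
  have hne' : (locus D.cycle).Nonempty := nonempty_Ici.image _
  have hout : ∀ t, C ⬝ᵥ e.symm (D.cycle t) = D.output ⬝ᵥ D.cycle t := fun t =>
    h.symm.output_map _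
  have hsw : ∀ t, SwitchesAt C (fun t => e.symm (D.cycle t)) t ↔ SwitchesAt D.output D.cycle t :=
    fun t => by simp only [SwitchesAt, hout]
  have hconv : ∀ x, IsTrajectory A B C x → (∃ t : ℝ, 0 ≤ t ∧ x t ≠ 0) →
      ConvergesTo x (locus fun t => e.symm (D.cycle t)) := by
    rintro x hx ⟨t, ht, hne⟩
    have := (Relay.Traj.convergesTo (h.isTrajectory hx)
      ⟨t, ht, by simpa using hne⟩).map e.symm hne'
    rw [hloc]
    simpa using this
  -- The isolating neighbourhood is the whole plane, as all nonconstant periodic trajectories share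
  -- one locus.
  refine ⟨fun t => e.symm (D.cycle t), 2 * D.half,
    ⟨h.symm.isPeriodicTrajectory D.isPeriodicTrajectory_cycle, univ, isOpen_univ, subset_univ _,
      fun y S hy _ => ?_⟩, fun ξ => ?_, ⟨?_, fun t ht h0 => ?_⟩, hconv, fun ξ => ?_⟩
  · rw [hloc, ← Relay.locus_eq_of_periodic (h.isPeriodicTrajectory hy), locus_map, image_image]
    simp
  · rw [hloc, e.symm.image_eq_preimage_symm]
    simpa using D.isSymmetric_cycle (e ξ)
  · simpa only [hsw] using D.isUnimodal_cycle.two_switches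
  · rw [hsw]
    exact D.isUnimodal_cycle.switches_of_zero t ht (by rw [← hout]; exact h0)
  · obtain ⟨x, hx, hx0, t, ht, hne⟩ := D.exists_traj (e ξ)
    have hx' := h.symm.isTrajectory hx
    exact ⟨_, hx', by simp [hx0], hconv _ hx' ⟨t, ht, by simpa using hne⟩⟩

/-! ### From the transfer function to the companion form -/

/-- The characteristic polynomial of a `2 × 2` matrix. -/
noncomputable def denPoly (A : Matrix (Fin 2) (Fin 2) ℝ) : ℝ[X] :=
  X ^ 2 + Polynomial.C (-(A 0 0 + A 1 1)) * X + Polynomial.C (A 0 0 * A 1 1 - A 0 1 * A 1 0)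

/-- The constant coefficient of the numerator `C adj(sI - A) B`. -/
def numConst (A : Matrix (Fin 2) (Fin 2) ℝ) (B C : Fin 2 → ℝ) : ℝ :=
  C 0 * (-A 1 1 * B 0 + A 0 1 * B 1) + C 1 * (A 1 0 * B 0 - A 0 0 * B 1)

/-- The numerator `C adj(sI - A) B`. -/
noncomputable def numPoly (A : Matrix (Fin 2) (Fin 2) ℝ) (B C : Fin 2 → ℝ) : ℝ[X] :=
  Polynomial.C (C 0 * B 0 + C 1 * B 1) * X + Polynomial.C (numConst A B C)

theorem natDegree_denPoly (A : Matrix (Fin 2) (Fin 2) ℝ) : (denPoly A).natDegree = 2 := by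
  unfold denPoly
  compute_degree!

theorem monic_denPoly (A : Matrix (Fin 2) (Fin 2) ℝ) : (denPoly A).Monic := by
  unfold denPoly
  monicity!

theorem transferFunction_eq (A : Matrix (Fin 2) (Fin 2) ℝ) (B C : Fin 2 → ℝ) :
    transferFunction A B C =
      algebraMap ℝ[X] (RatFunc ℝ) (numPoly A B C) / algebraMap ℝ[X] (RatFunc ℝ) (denPoly A) := by
  have hdet : ((RatFunc.X : RatFunc ℝ) • (1 : Matrix (Fin 2) (Fin 2) (RatFunc ℝ))
      - A.map (fun a => RatFunc.C a)).det = algebraMap ℝ[X] (RatFunc ℝ) (denPoly A) := by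
    rw [Matrix.det_fin_two]
    simp [denPoly]
    ring
  rw [transferFunction, Matrix.inv_def, hdet, Ring.inverse_eq_inv', Matrix.adjugate_fin_two]
  simp [dotProduct, Fin.sum_univ_two, numPoly, numConst, Matrix.mulVec, div_eq_mul_inv]
  ring

/-- A realization of order two is coprime: numerator and denominator can be read off. -/
theorem num_denom_of_realization {G : RatFunc ℝ} {A : Matrix (Fin 2) (Fin 2) ℝ} {B C : Fin 2 → ℝ}
    (horder : G.denom.natDegree = 2) (hreal : transferFunction A B C = G) :
    G.num = numPoly A B C ∧ G.denom = denPoly A := by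
  have hG := hreal.symm.trans (transferFunction_eq A B C)
  have hne := (monic_denPoly A).ne_zero
  -- The reduced denominator divides the characteristic polynomial; both are monic of degree 2.
  have hden : denPoly A = G.denom := by
    refine eq_of_monic_of_dvd_of_natDegree_le G.monic_denom (monic_denPoly A) ?_
      (by rw [natDegree_denPoly, horder])
    rw [hG]
    exact RatFunc.denom_div_dvd _ _
  refine ⟨?_, hden.symm⟩
  have h := G.num_div_denom.trans hG
  have hne' : algebraMap ℝ[X] (RatFunc ℝ) (denPoly A) ≠ 0 := by simpa using hne
  rw [← hden, div_left_inj' hne'] at h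
  exact RatFunc.algebraMap_injective ℝ h

/-- The coefficients of a monic quadratic Hurwitz polynomial are positive. -/
theorem pos_of_hurwitz {a b : ℝ} (h : ∀ s : ℂ, s ^ 2 + a * s + b = 0 → s.re < 0) :
    0 < a ∧ 0 < b := by
  rcases le_or_gt 0 (a ^ 2 - 4 * b) with hd | hd
  · have hs := Real.sq_sqrt hd
    set r := Real.sqrt (a ^ 2 - 4 * b)
    have hroot : ∀ t : ℝ, t ^ 2 + a * t + b = 0 → t < 0 := fun t ht => by
      have := h t (by exact_mod_cast ht)
      simpa using this
    have h1 := hroot ((-a + r) / 2) (by linear_combination hs / 4)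
    have h2 := hroot ((-a - r) / 2) (by linear_combination hs / 4)
    refine ⟨by linarith, ?_⟩
    have := mul_pos_of_neg_of_neg h1 h2
    linear_combination this - hs / 4
  · have hs := Real.sq_sqrt (show 0 ≤ 4 * b - a ^ 2 by linarith)
    set r := Real.sqrt (4 * b - a ^ 2)
    have h1 := h ⟨-a / 2, r / 2⟩ (by
      apply Complex.ext
      · simp [pow_two]
        linear_combination -hs / 4
      · simp [pow_two]
        ring)
    simp only at h1
    refine ⟨by linarith, by nlinarith [sq_nonneg a]⟩

/-- The coordinates `(C x, C A x)` of an observable pair. -/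
noncomputable def observabilityEquiv (A : Matrix (Fin 2) (Fin 2) ℝ) (C : Fin 2 → ℝ)
    (h : IsUnit (Matrix.of ![C, Matrix.vecMul C A]).det) : (Fin 2 → ℝ) ≃L[ℝ] (Fin 2 → ℝ) :=
  (Matrix.toLinearEquiv' _ (Matrix.invertibleOfIsUnitDet _ h)).toContinuousLinearEquiv

theorem observabilityEquiv_apply (A : Matrix (Fin 2) (Fin 2) ℝ) (C : Fin 2 → ℝ)
    (h : IsUnit (Matrix.of ![C, Matrix.vecMul C A]).det) (ξ : Fin 2 → ℝ) :
    observabilityEquiv A C h ξ = ![C ⬝ᵥ ξ, Matrix.vecMul C A ⬝ᵥ ξ] := by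
  change (Matrix.of ![C, Matrix.vecMul C A]).mulVec ξ = _
  ext i
  fin_cases i <;> rfl

end RelayFeedback

open RelayFeedback in
theorem theorem3 (G : RatFunc ℝ)
    (hproper : RelayFeedback.IsProper G)
    (horder : G.denom.natDegree = 2)
    (hstable : RelayFeedback.IsHurwitz G)
    (hzero : RelayFeedback.IsNonminimumPhase G)
    (hgain : 0 < RelayFeedback.dcGain G)
    (A : Matrix (Fin 2) (Fin 2) ℝ) (B C : Fin 2 → ℝ)
    (hreal : RelayFeedback.transferFunction A B C = G) :
    ∃ (c : ℝ → Fin 2 → ℝ) (T : ℝ),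
      RelayFeedback.IsLimitCycle A B C c T ∧
      RelayFeedback.IsSymmetric c ∧
      RelayFeedback.IsUnimodal C c T ∧
      (∀ x : ℝ → Fin 2 → ℝ, RelayFeedback.IsTrajectory A B C x → (∃ t : ℝ, 0 ≤ t ∧ x t ≠ 0) →
        RelayFeedback.ConvergesTo x (RelayFeedback.locus c)) ∧
      (∀ ξ : Fin 2 → ℝ, ∃ x : ℝ → Fin 2 → ℝ, RelayFeedback.IsTrajectory A B C x ∧ x 0 = ξ ∧
        RelayFeedback.ConvergesTo x (RelayFeedback.locus c)) := by
  obtain ⟨hnum, hden⟩ := num_denom_of_realization horder hreal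
  obtain ⟨a, ha⟩ : ∃ a, a = -(A 0 0 + A 1 1) := ⟨_, rfl⟩
  obtain ⟨b, hb⟩ : ∃ b, b = A 0 0 * A 1 1 - A 0 1 * A 1 0 := ⟨_, rfl⟩
  obtain ⟨n, hn⟩ : ∃ n, n = numConst A B C := ⟨_, rfl⟩
  obtain ⟨k, hk⟩ : ∃ k, k = -(C 0 * B 0 + C 1 * B 1) := ⟨_, rfl⟩
  obtain ⟨hapos, hbpos⟩ : 0 < a ∧ 0 < b := pos_of_hurwitz fun s hs => hstable s (by
    rw [hden]
    simp only [denPoly, map_add, map_mul, map_pow, Polynomial.aeval_X, Polynomial.aeval_C,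
      Complex.coe_algebraMap, ← ha, ← hb]
    exact hs)
  have hnpos : 0 < n := by
    rw [dcGain, RatFunc.eval, hnum, hden] at hgain
    simp only [numPoly, denPoly, Polynomial.eval₂_add, Polynomial.eval₂_mul, Polynomial.eval₂_pow,
      Polynomial.eval₂_X, Polynomial.eval₂_C, RingHom.id_apply, ← hb, ← hn, mul_zero, zero_add,
      ne_eq, OfNat.ofNat_ne_zero, not_false_eq_true, zero_pow] at hgain
    exact (div_pos_iff_of_pos_right hbpos).1 hgain
  obtain ⟨z, hz, hkz⟩ : ∃ z, 0 < z ∧ n = k * z := by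
    obtain ⟨z, hz, h⟩ := hzero
    rw [hnum] at h
    simp only [numPoly, Polynomial.eval_add, Polynomial.eval_mul, Polynomial.eval_C,
      Polynomial.eval_X, ← hn] at h
    exact ⟨z, hz, by rw [hk]; linarith⟩
  have hkpos : 0 < k := pos_of_mul_pos_left (hkz ▸ hnpos) hz.le
  have hunit : IsUnit (Matrix.of ![C, Matrix.vecMul C A]).det := by
    rw [isUnit_iff_ne_zero]
    intro h0
    -- k² times the denominator at the zero z is, up to sign, the product of the controllability and
    -- observability determinants. It is positive because z, a, b and k are, so observability cannot
    -- fail.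
    have hres : k ^ 2 * (z ^ 2 + a * z + b) = 0 := by
      have h1 : k ^ 2 * (z ^ 2 + a * z + b) = n ^ 2 + a * k * n + b * k ^ 2 := by
        rw [hkz]
        ring
      rw [h1]
      simp only [Matrix.det_fin_two, Matrix.of_apply, Matrix.cons_val_zero, Matrix.cons_val_one,
        Matrix.vecMul, dotProduct, Fin.sum_univ_two] at h0
      rw [hn, hk, ha, hb, numConst]
      linear_combination -(B 0 * (A 1 0 * B 0 + A 1 1 * B 1) - B 1 * (A 0 0 * B 0 + A 0 1 * B 1)) * h0
    have : 0 < k ^ 2 * (z ^ 2 + a * z + b) := by positivity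
    exact this.ne' hres
  obtain ⟨β, γ, h0, h1, h2, h3, h4, h5⟩ := exists_impulse_response hapos hbpos
  -- The DC gain is n / b.
  refine Relay.exists_limitCycle ⟨a, b, k, n / b, hapos, hbpos, hkpos, div_pos hnpos hbpos, β, γ, h0,
    h1, h2, h3, h4, h5⟩ (e := observabilityEquiv A C hunit) ⟨fun ξ => ?_, ?_, fun ξ => ?_⟩
  · simp only [observabilityEquiv_apply, Relay.stateMatrix]
    ext i
    fin_cases i
    · simp [dotProduct, Matrix.mulVec, Matrix.vecMul, Fin.sum_univ_two]
      ring
    · simp [dotProduct, Matrix.mulVec, Matrix.vecMul, Fin.sum_univ_two, ha, hb]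
      ring
  · simp only [observabilityEquiv_apply, Relay.input, mul_div_cancel₀ _ hbpos.ne']
    ext i
    fin_cases i
    · simp [dotProduct, Fin.sum_univ_two, hk]
    · simp [dotProduct, Matrix.vecMul, Fin.sum_univ_two, hn, ha, hk, numConst]
      ring
  · rw [Relay.output_dotProduct, observabilityEquiv_apply]
    rfl
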